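/- Let $\mathbb{L}/\mathbb{K}$ be a cyclic Galois extension of fields of finite degree $n$, let $\sigma$ be a generator of $\mathrm{Gal}(\mathbb{L}/\mathbb{K})$, and let $\mathbb{L}'$ be an intermediate field with $[\mathbb{L}:\mathbb{L}']=2$ (so $n$ is even and $\mathbb L'$ is unique). Let $R=\mathbb{L}[x;\sigma]$ be the skew polynomial ring with $xa=\sigma(a)x$ for $a\in\mathbb L$, and let $Z(R)=\mathbb{K}[x^n]$ be its centre. For $f\in R$ let $\mathcal{E}(f)=\{g\in R: fg\in Rf\}/Rf$ be its eigenring. All isomorphisms below are isomorphisms of $\mathbb{K}$-algebras. (1) Let $f\in R$ be monic and irreducible with $f\notin Z(R)$ and $d=\deg f\ge 2$, and let $f_0$ be its constant coefficient. Let $\gamma\in\mathbb{L}$ be such that $\gamma/f_0\notin\mathbb{L}'$ and $\mathrm{N}_{\mathbb{L}/\mathbb{K}}(\gamma)$ is not a square in $\mathbb{K}$ (so $\gamma\notin\mathbb{L}'$). Let $\mathbb{A}=(R/Rf,\star_D)$, where $$\Big((a_0'+\gamma a_0'')+\sum_{i=1}^{d-1}a_ix^i\Big)\star_D b=\Big((a_0'+\gamma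 a_0'')+\sum_{i=1}^{d-1}a_ix^i-\frac{\gamma}{f_0}a_0''f\Big)\,b \pmod{Rf}$$ for $a_0',a_0''\in\mathbb{L}'$, $a_i\in\mathbb{L}$, $b\in R/Rf$. Then the left, middle and right nuclei and the centre of $\mathbb A$ satisfy $$\mathbb{N}_l(\mathbb{A})\cong\mathbb{L}',\qquad \mathbb{N}_m(\mathbb{A})\cong\mathbb{L}',\qquad \mathbb{N}_r(\mathbb{A})\cong\mathcal{E}(f),\qquad Z(\mathbb{A})\cong\mathbb{K}.$$ (2) Let $F(y)\in\mathbb{K}[y]$ be monic and irreducible of degree $s$, with $F(y)\ne y$. Suppose that $F(x^n)$ is a product of $m$ irreducible elements of $R$, and put $\ell=\ell_F=n/m$. Let $R_F=R/RF(x^n)$ and let $E_F$ be the centre of $R_F$. Let $f\notin Z(R)$ be a monic irreducible factor of $F(x^n)$ in $R$, let $\gamma\in\mathbb{L}\setminus\{0\}$, and let $k$ be an integer with $1\le k\le m/2$ and $sk\ell\ge 2$. Let $$\mathcal{C}=D_{n,s\ell,k}(\gamma,F)=\Big\{a_0'+\sum_{i=1}^{sk\ell-1}a_ix^i+\gamma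 a_0''x^{sk\ell}+RF(x^n): a_i\in\mathbb{L},\ a_0',a_0''\in\mathbb{L}'\Big\}\subseteq R_F\cong M_m(\mathcal{E}(f)).$$ Then $$\mathcal{I}_\ell(\mathcal{C})\cong\mathbb{L}',\qquad \mathcal{I}_r(\mathcal{C})\cong\mathbb{L}',\qquad C(\mathcal{C})\cong E_F,\qquad Z(\mathcal{C})\cong\mathbb{K},$$ where $\mathcal{I}_\ell(\mathcal{C})=\{A: A\mathcal{C}\subseteq\mathcal{C}\}$ and $\mathcal{I}_r(\mathcal{C})=\{B:\mathcal{C}B\subseteq\mathcal{C}\}$ are the left and right idealisers, $C(\mathcal{C})=\{A: AX=XA \text{ for all } X\in\mathcal{C}\}$ is the centraliser, and $Z(\mathcal{C})=\mathcal{I}_\ell(\mathcal{C})\cap C(\mathcal{C})$ is the centre. This holds for $\mathcal C$ as a subset of $R_F$, and likewise for its image in $M_m(\mathcal{E}(f))$ under any $\mathbb{K}$-algebra isomorphism $R_F\cong M_m(\mathcal{E}(f))$. -/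

import Mathlib

noncomputable section

/-! ## The skew polynomial ring `L[x; σ]` -/

section SkewPolynomials

variable {K L : Type*} [Field K] [Field L] [Algebra K L]

/-- The action of the free monoid on one generator on `L` in which the generator acts as `σ`. -/
@[reducible] def skewAction (σ : L ≃ₐ[K] L) : MulSemiringAction (Multiplicative ℕ) L :=
  MulSemiringAction.compHom L (powersHom (L ≃ₐ[K] L) σ)

theorem skewAction_smul (σ : L ≃ₐ[K] L) (i : ℕ) (a : L) :
    (skewAction σ).smul (Multiplicative.ofAdd i) a = (σ ^ i) a := rfl

theorem skewAction_smulCommClass (σ : L ≃ₐ[K] L) :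
    letI := skewAction σ
    SMulCommClass (Multiplicative ℕ) K L :=
  letI := skewAction σ
  ⟨fun g c a => map_smul (σ ^ (Multiplicative.toAdd g)) c a⟩

/-- The skew polynomial ring `R = L[x; σ]`: polynomials `∑ aᵢ xⁱ` with coefficients in `L`,
multiplied by the rule `x a = σ(a) x`. -/
def SkewPoly (_σ : L ≃ₐ[K] L) : Type _ := SkewPolynomial L

namespace SkewPoly

variable {σ : L ≃ₐ[K] L}

instance instRing : Ring (SkewPoly σ) :=
  fast_instance% @SkewMonoidAlgebra.instRing L (Multiplicative ℕ) _ _ (skewAction σ)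

instance instAlgebra : Algebra K (SkewPoly σ) :=
  fast_instance% @SkewMonoidAlgebra.instAlgebraOfSMulCommClass K (Multiplicative ℕ) _ _ L _ _ (skewAction σ)
    (skewAction_smulCommClass σ)

variable (σ) in
/-- The monomial `a xⁱ`. -/
def monomial (i : ℕ) (a : L) : SkewPoly σ := SkewPolynomial.monomial i a

variable (σ) in
/-- The indeterminate `x`. -/
def X : SkewPoly σ := monomial σ 1 1

/-- The coefficient of `xⁱ` (with coefficients written on the left). -/
def coeff (p : SkewPoly σ) (i : ℕ) : L := SkewPolynomial.coeff p i

/-- The degree (equal to `0` for the zero polynomial). -/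
def natDegree (p : SkewPoly σ) : ℕ := (SkewPolynomial.support p).sup id

/-- Leading coefficient equal to one. -/
def Monic (p : SkewPoly σ) : Prop := p.coeff p.natDegree = 1

variable (σ) in
/-- `F(xⁿ)` with `n = [L : K]`, for a polynomial `F` over `K`. -/
def evalXPow (F : Polynomial K) : SkewPoly σ :=
  Polynomial.aeval (X σ ^ Module.finrank K L) F


/-! ### Elementary facts used to build the objects below -/

@[ext] theorem ext {p q : SkewPoly σ} (h : ∀ i, p.coeff i = q.coeff i) : p = q :=
  SkewPolynomial.ext h

variable (σ) in
/-- The `i`-th coefficient as a `K`-linear map. -/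
def lcoeff (i : ℕ) : SkewPoly σ →ₗ[K] L where
  toFun p := p.coeff i
  map_add' p q := SkewPolynomial.coeff_add p q i
  map_smul' c p := DFunLike.congr_fun (SkewMonoidAlgebra.coeff_smul c p) (Multiplicative.ofAdd i)

theorem lcoeff_apply (p : SkewPoly σ) (i : ℕ) : lcoeff σ i p = p.coeff i := rfl

theorem coeff_add (p q : SkewPoly σ) (i : ℕ) : (p + q).coeff i = p.coeff i + q.coeff i :=
  map_add (lcoeff σ i) p q

theorem coeff_sub (p q : SkewPoly σ) (i : ℕ) : (p - q).coeff i = p.coeff i - q.coeff i :=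
  map_sub (lcoeff σ i) p q

theorem coeff_monomial (i j : ℕ) (a : L) :
    (monomial σ i a).coeff j = if i = j then a else 0 :=
  SkewPolynomial.coeff_monomial

variable (σ) in
/-- `a ↦ a xⁱ` as a `K`-linear map. -/
def lmonomial (i : ℕ) : L →ₗ[K] SkewPoly σ where
  toFun := monomial σ i
  map_add' a b := by ext j; simp only [coeff_add, coeff_monomial]; split_ifs <;> simp
  map_smul' c a := by
    ext j
    simp only [RingHom.id_apply, ← lcoeff_apply, map_smul]
    simp only [lcoeff_apply, coeff_monomial]; split_ifs <;> simp

theorem lmonomial_apply (i : ℕ) (a : L) : lmonomial σ i a = monomial σ i a := rfl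

theorem one_def : (1 : SkewPoly σ) = monomial σ 0 1 := rfl

theorem monomial_mul_monomial (i j : ℕ) (a b : L) :
    monomial σ i a * monomial σ j b = monomial σ (i + j) (a * (σ ^ i) b) :=
  letI := skewAction σ
  SkewMonoidAlgebra.single_mul_single

/-- The defining relation `x a = σ(a) x`. -/
theorem X_mul_monomial_zero (a : L) : X σ * monomial σ 0 a = monomial σ 0 (σ a) * X σ := by
  simp [X, monomial_mul_monomial]

theorem X_pow (i : ℕ) : X σ ^ i = monomial σ i 1 := by
  induction i with
  | zero => rfl
  | succ i ih => rw [pow_succ, ih, X, monomial_mul_monomial]; simp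

theorem exists_bound (p : SkewPoly σ) : ∃ N, ∀ i, N ≤ i → p.coeff i = 0 := by
  refine ⟨(SkewPolynomial.support p).sup id + 1, fun i hi => ?_⟩
  by_contra h
  have : i ≤ (SkewPolynomial.support p).sup id :=
    Finset.le_sup (f := id) (SkewPolynomial.mem_support_iff.2 h)
  omega

theorem coeff_eq_zero_of_natDegree_lt (p : SkewPoly σ) {i : ℕ} (hi : p.natDegree < i) :
    p.coeff i = 0 := by
  by_contra h
  exact absurd (Finset.le_sup (f := id) (SkewPolynomial.mem_support_iff.2 h)) (not_le.2 hi)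

theorem eq_sum_monomial {p : SkewPoly σ} {N : ℕ} (h : ∀ i, N ≤ i → p.coeff i = 0) :
    p = ∑ i ∈ Finset.range N, monomial σ i (p.coeff i) := by
  ext j
  rw [← lcoeff_apply (∑ i ∈ Finset.range N, _), map_sum]
  simp only [lcoeff_apply, coeff_monomial, Finset.sum_ite_eq', Finset.mem_range]
  split_ifs with hj
  · rfl
  · exact h j (not_lt.1 hj)

theorem coeff_mul {p q : SkewPoly σ} {M N : ℕ} (hp : ∀ i, M ≤ i → p.coeff i = 0)
    (hq : ∀ i, N ≤ i → q.coeff i = 0) (j : ℕ) :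
    (p * q).coeff j = ∑ a ∈ Finset.range M, ∑ b ∈ Finset.range N,
      if a + b = j then p.coeff a * (σ ^ a) (q.coeff b) else 0 := by
  conv_lhs => rw [eq_sum_monomial hp, eq_sum_monomial hq]
  rw [Finset.sum_mul_sum, ← lcoeff_apply, map_sum]
  simp only [map_sum, lcoeff_apply, monomial_mul_monomial, coeff_monomial]

theorem coeff_mul_top {p q : SkewPoly σ} {M N : ℕ} (hp : ∀ i, M < i → p.coeff i = 0)
    (hq : ∀ i, N < i → q.coeff i = 0) :
    (p * q).coeff (M + N) = p.coeff M * (σ ^ M) (q.coeff N) := by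
  rw [coeff_mul (M := M + 1) (N := N + 1) (fun i hi => hp i hi) (fun i hi => hq i hi)]
  rw [Finset.sum_eq_single M, Finset.sum_eq_single N]
  · simp
  · intro b _ hb; rw [if_neg (by omega)]
  · simp
  · intro a ha ha'
    refine Finset.sum_eq_zero fun b hb => ?_
    rw [Finset.mem_range] at ha hb
    rw [if_neg (by omega)]
  · simp

theorem coeff_mul_eq_zero {p q : SkewPoly σ} {M N j : ℕ} (hp : ∀ i, M < i → p.coeff i = 0)
    (hq : ∀ i, N < i → q.coeff i = 0) (hj : M + N < j) : (p * q).coeff j = 0 := by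
  rw [coeff_mul (M := M + 1) (N := N + 1) (fun i hi => hp i hi) (fun i hi => hq i hi)]
  refine Finset.sum_eq_zero fun a ha => Finset.sum_eq_zero fun b hb => ?_
  rw [Finset.mem_range] at ha hb
  rw [if_neg (by omega)]

variable (σ) in
/-- The skew polynomials of degree less than `d`. -/
def degreeLT (d : ℕ) : Submodule K (SkewPoly σ) where
  carrier := {p | ∀ i, d ≤ i → p.coeff i = 0}
  add_mem' hp hq i hi := by rw [coeff_add, hp i hi, hq i hi, add_zero]
  zero_mem' _ _ := rfl
  smul_mem' c p hp i hi := by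
    rw [← lcoeff_apply, map_smul, lcoeff_apply, hp i hi, smul_zero]

/-- The `K`-linear map sending a skew polynomial of degree less than `deg f` to its class
in `R / Rf`. -/
def degreeLTToQuotient (f : SkewPoly σ) :
    degreeLT σ f.natDegree →ₗ[K] SkewPoly σ ⧸ Ideal.span {f} :=
  ((Ideal.span {f}).mkQ.restrictScalars K).comp (degreeLT σ f.natDegree).subtype

theorem degreeLTToQuotient_bijective {f : SkewPoly σ} (hf : f.Monic) :
    Function.Bijective (degreeLTToQuotient f) := by
  constructor
  · rw [injective_iff_map_eq_zero]
    rintro ⟨p, hp⟩ h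
    have h' : p ∈ Ideal.span {f} := (Submodule.Quotient.mk_eq_zero _).1 h
    obtain ⟨g, rfl⟩ := Ideal.mem_span_singleton'.1 h'
    have key : ∀ N, (∀ i, N ≤ i → g.coeff i = 0) → g = 0 := by
      intro N
      induction N with
      | zero => intro hN; ext i; exact hN i (Nat.zero_le i)
      | succ N ih =>
        intro hN
        refine ih fun i hi => ?_
        rcases hi.eq_or_lt with rfl | hi
        · have h1 := coeff_mul_top (p := g) (q := f) (M := N) (N := f.natDegree)
            (fun i hi => hN i hi) (fun i hi => coeff_eq_zero_of_natDegree_lt f hi)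
          rw [hp _ (Nat.le_add_left _ _), show f.coeff f.natDegree = 1 from hf, map_one,
            mul_one] at h1
          exact h1.symm
        · exact hN i hi
    obtain ⟨N, hN⟩ := exists_bound g
    ext
    simp [key N hN]
  · intro z
    obtain ⟨p, rfl⟩ := Submodule.Quotient.mk_surjective _ z
    obtain ⟨N, hN⟩ := exists_bound p
    induction N generalizing p with
    | zero => exact ⟨⟨p, fun i _ => hN i (Nat.zero_le i)⟩, rfl⟩
    | succ N ih =>
      by_cases hd : N + 1 ≤ f.natDegree
      · exact ⟨⟨p, fun i hi => hN i (hd.trans hi)⟩, rfl⟩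
      · set q := monomial σ (N - f.natDegree) (p.coeff N) with hq
        have hq0 : ∀ i, N - f.natDegree < i → q.coeff i = 0 := fun i hi => by
          rw [hq, coeff_monomial, if_neg (by omega)]
        have hf0 : ∀ i, f.natDegree < i → f.coeff i = 0 :=
          fun i hi => coeff_eq_zero_of_natDegree_lt f hi
        obtain ⟨r, hr⟩ := ih (p - q * f) fun i hi => by
          rw [coeff_sub]
          rcases hi.eq_or_lt with rfl | hi
          · have h1 := coeff_mul_top hq0 hf0
            rw [show f.coeff f.natDegree = 1 from hf, map_one, mul_one,
              Nat.sub_add_cancel (by omega), hq, coeff_monomial, if_pos rfl] at h1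
            rw [h1, sub_self]
          · rw [hN i hi, coeff_mul_eq_zero hq0 hf0 (by omega), sub_zero]
        refine ⟨r, hr.trans ?_⟩
        rw [Submodule.Quotient.eq]
        rw [sub_sub_cancel_left]
        exact neg_mem (Ideal.mem_span_singleton'.2 ⟨q, rfl⟩)

/-- For monic `f`, every class in `R / Rf` has a unique representative of degree less than
`deg f`. -/
def quotientEquiv (f : SkewPoly σ) (hf : f.Monic) :
    (SkewPoly σ ⧸ Ideal.span {f}) ≃ₗ[K] degreeLT σ f.natDegree :=
  (LinearEquiv.ofBijective _ (degreeLTToQuotient_bijective hf)).symm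

section Central

variable [FiniteDimensional K L] [IsGalois K L]

theorem pow_finrank_eq_one (σ : L ≃ₐ[K] L) : σ ^ Module.finrank K L = 1 := by
  rw [← IsGalois.card_aut_eq_finrank K L]
  exact pow_card_eq_one'

theorem X_pow_mem_center :
    X σ ^ Module.finrank K L ∈ Subalgebra.center K (SkewPoly σ) := by
  rw [Subalgebra.mem_center_iff]
  intro p
  obtain ⟨N, hN⟩ := exists_bound p
  rw [eq_sum_monomial hN, Finset.sum_mul, Finset.mul_sum]
  refine Finset.sum_congr rfl fun i _ => ?_
  rw [X_pow, monomial_mul_monomial, monomial_mul_monomial, pow_finrank_eq_one, map_one,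
    mul_one, one_mul, add_comm]
  rfl

theorem evalXPow_mem_center (F : Polynomial K) :
    evalXPow σ F ∈ Subalgebra.center K (SkewPoly σ) := by
  have h := Polynomial.aeval_mem_adjoin_singleton K (p := F) (X σ ^ Module.finrank K L)
  exact (Algebra.adjoin_le (Set.singleton_subset_iff.2 X_pow_mem_center)) h

/-- As `F(xⁿ)` is central, the left ideal `R F(xⁿ)` is two-sided. -/
instance isTwoSided_span_evalXPow (F : Polynomial K) :
    (Ideal.span {evalXPow σ F}).IsTwoSided :=
  ⟨fun {a} b ha => by
    obtain ⟨c, rfl⟩ := Ideal.mem_span_singleton'.1 ha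
    have hz := Subalgebra.mem_center_iff.1 (evalXPow_mem_center (σ := σ) F) b
    rw [mul_assoc, ← hz, ← mul_assoc]
    exact Ideal.mem_span_singleton'.2 ⟨_, rfl⟩⟩

end Central

end SkewPoly

/-! ## The eigenring -/

/-- The left idealiser `I(f) = {g ∈ R : f g ∈ R f}` of `f`. -/
def polyIdealiser {σ : L ≃ₐ[K] L} (f : SkewPoly σ) : Subalgebra K (SkewPoly σ) where
  carrier := {g | f * g ∈ Ideal.span {f}}
  mul_mem' {a b} ha hb := by
    rw [Set.mem_ofPred_eq] at ha hb ⊢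
    obtain ⟨c, hc⟩ := Ideal.mem_span_singleton'.1 ha
    rw [← mul_assoc, ← hc, mul_assoc]
    exact Ideal.mul_mem_left _ _ hb
  add_mem' {a b} ha hb := by
    rw [Set.mem_ofPred_eq] at ha hb ⊢
    rw [mul_add]
    exact add_mem ha hb
  algebraMap_mem' r := by
    rw [Set.mem_ofPred_eq, ← Algebra.commutes]
    exact Ideal.mul_mem_left _ _ (Ideal.mem_span_singleton_self f)

/-- `R f`, viewed as an ideal of `I(f)`. -/
def eigenIdeal {σ : L ≃ₐ[K] L} (f : SkewPoly σ) : Ideal (polyIdealiser f) :=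
  Ideal.comap (polyIdealiser f).val (Ideal.span {f})

instance {σ : L ≃ₐ[K] L} (f : SkewPoly σ) : (eigenIdeal f).IsTwoSided :=
  ⟨fun {a} b ha => by
    obtain ⟨c, hc⟩ := Ideal.mem_span_singleton'.1
      (show (a : SkewPoly σ) ∈ Ideal.span {f} from ha)
    change (a : SkewPoly σ) * (b : SkewPoly σ) ∈ Ideal.span {f}
    rw [← hc, mul_assoc]
    exact Ideal.mul_mem_left _ _ b.2⟩

/-- The eigenring `E(f) = I(f) / R f`. -/
abbrev Eigenring {σ : L ≃ₐ[K] L} (f : SkewPoly σ) : Type _ := polyIdealiser f ⧸ eigenIdeal f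

/-! ## The algebra `(R / Rf, ⋆_D)` -/

theorem notMem_of_norm_not_square [FiniteDimensional K L] (L' : IntermediateField K L)
    (hL' : Module.finrank L' L = 2) {γ : L} (hN : ¬ IsSquare (Algebra.norm K γ)) : γ ∉ L' := by
  intro h
  apply hN
  refine ⟨Algebra.norm K (⟨γ, h⟩ : L'), ?_⟩
  have h1 := Algebra.norm_norm (R := K) (S := L') (a := algebraMap L' L ⟨γ, h⟩)
  rw [Algebra.norm_algebraMap, hL', map_pow, pow_two] at h1
  exact h1.symm

/-- For `[L : L'] = 2` and `γ ∉ L'`, the isomorphism `L' × L' ≃ L`, `(a', a'') ↦ a' + γ a''`. -/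
def splitEquiv [FiniteDimensional K L] (L' : IntermediateField K L)
    (hL' : Module.finrank L' L = 2) (γ : L) (hγ : γ ∉ L') : (L' × L') ≃ₗ[L'] L :=
  LinearEquiv.ofInjectiveOfFinrankEq
    (LinearMap.coprod (Algebra.linearMap L' L) (LinearMap.toSpanSingleton L' L γ))
    (by
      rw [injective_iff_map_eq_zero]
      rintro ⟨a, b⟩ h
      have h' : (a : L) + b * γ = 0 := h
      have hb : b = 0 := by
        by_contra hb
        have hb' : (b : L) ≠ 0 := fun h0 => hb (Subtype.ext h0)
        apply hγ
        have : γ = ((-a / b : L') : L) := by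
          push_cast
          field_simp
          linear_combination h'
        rw [this]
        exact SetLike.coe_mem _
      subst hb
      simp only [ZeroMemClass.coe_zero, zero_mul, add_zero, ZeroMemClass.coe_eq_zero] at h'
      rw [h']; rfl)
    (by rw [hL', Module.finrank_prod, Module.finrank_self])

theorem splitEquiv_apply [FiniteDimensional K L] (L' : IntermediateField K L)
    (hL' : Module.finrank L' L = 2) (γ : L) (hγ : γ ∉ L') (a' a'' : L') :
    splitEquiv L' hL' γ hγ (a', a'') = a' + γ * a'' := by
  rw [mul_comm]; rfl

section HughesKleinfeld

variable [FiniteDimensional K L] {σ : L ≃ₐ[K] L}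

/-- Write a class in `R / Rf` as that of `a = (a₀' + γ a₀'') + ∑_{1 ≤ i < deg f} aᵢ xⁱ` with
`a₀', a₀'' ∈ L'`. The map sends it to the skew polynomial `a - (γ / f₀) a₀'' f`, where `f₀` is the
constant coefficient of `f`. -/
def hughesLift (L' : IntermediateField K L) (hL' : Module.finrank L' L = 2) (γ : L)
    (hN : ¬ IsSquare (Algebra.norm K γ)) (f : SkewPoly σ) (hf : f.Monic) :
    (SkewPoly σ ⧸ Ideal.span {f}) →ₗ[K] SkewPoly σ where
  toFun z :=
    let a : SkewPoly σ := (f.quotientEquiv hf z : SkewPoly σ)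
    let a₀'' : L' :=
      ((splitEquiv L' hL' γ (notMem_of_norm_not_square L' hL' hN)).symm (a.coeff 0)).2
    a - SkewPoly.monomial σ 0 (γ / f.coeff 0 * a₀'') * f
  map_add' z w := by
    simp only [map_add, Submodule.coe_add, SkewPoly.coeff_add, Prod.snd_add,
      IntermediateField.coe_add, mul_add, ← SkewPoly.lmonomial_apply, add_mul]
    abel
  map_smul' c z := by
    simp only [map_smul, Submodule.coe_smul, RingHom.id_apply, ← SkewPoly.lcoeff_apply]
    rw [← algebraMap_smul L' c (SkewPoly.lcoeff σ 0 _), map_smul, Prod.smul_snd,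
      smul_eq_mul, IntermediateField.coe_mul,
      show ((algebraMap K L' c : L') : L) = algebraMap K L c from rfl, mul_left_comm,
      ← Algebra.smul_def, ← SkewPoly.lmonomial_apply, map_smul, smul_mul_assoc, smul_sub]
    rfl

/-- The `K`-vector space `R / Rf` with the (nonassociative) multiplication `⋆_D`. -/
def HKAlgebra (L' : IntermediateField K L) (_hL' : Module.finrank L' L = 2) (γ : L)
    (_hN : ¬ IsSquare (Algebra.norm K γ)) (f : SkewPoly σ) (_hf : f.Monic) : Type _ :=
  SkewPoly σ ⧸ Ideal.span {f}

namespace HKAlgebra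

variable {L' : IntermediateField K L} {hL' : Module.finrank L' L = 2} {γ : L}
  {hN : ¬ IsSquare (Algebra.norm K γ)} {f : SkewPoly σ} {hf : f.Monic}

instance instAddCommGroup : AddCommGroup (HKAlgebra L' hL' γ hN f hf) :=
  fast_instance% inferInstanceAs (AddCommGroup (SkewPoly σ ⧸ Ideal.span {f}))

instance instModule : Module K (HKAlgebra L' hL' γ hN f hf) :=
  inferInstanceAs (Module K (SkewPoly σ ⧸ Ideal.span {f}))

/-- `a ⋆_D b = (a - (γ / f₀) a₀'' f) b mod Rf`, the product of a skew polynomial with a class in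
the left `R`-module `R / Rf`. -/
instance instMul : Mul (HKAlgebra L' hL' γ hN f hf) where
  mul a b := (show SkewPoly σ ⧸ Ideal.span {f} from
    hughesLift L' hL' γ hN f hf a • (show SkewPoly σ ⧸ Ideal.span {f} from b))

theorem mul_def (a b : HKAlgebra L' hL' γ hN f hf) :
    a * b = (show SkewPoly σ ⧸ Ideal.span {f} from
      hughesLift L' hL' γ hN f hf a • (show SkewPoly σ ⧸ Ideal.span {f} from b)) := rfl

instance instNonUnitalNonAssocRing :
    NonUnitalNonAssocRing (HKAlgebra L' hL' γ hN f hf) where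
  __ := instAddCommGroup
  __ := instMul
  left_distrib a b c := smul_add (hughesLift L' hL' γ hN f hf a)
    (show SkewPoly σ ⧸ Ideal.span {f} from b) (show SkewPoly σ ⧸ Ideal.span {f} from c)
  right_distrib a b c := by
    change hughesLift L' hL' γ hN f hf (a + b) • (show SkewPoly σ ⧸ Ideal.span {f} from c) = _
    exact (congrArg (· • (show SkewPoly σ ⧸ Ideal.span {f} from c))
      (map_add (hughesLift L' hL' γ hN f hf) a b)).trans (add_smul _ _ _)
  zero_mul a := (congrArg (· • (show SkewPoly σ ⧸ Ideal.span {f} from a))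
      (map_zero (hughesLift L' hL' γ hN f hf))).trans (zero_smul _ _)
  mul_zero a := smul_zero (A := SkewPoly σ ⧸ Ideal.span {f}) (hughesLift L' hL' γ hN f hf a)

instance instIsScalarTower :
    IsScalarTower K (HKAlgebra L' hL' γ hN f hf) (HKAlgebra L' hL' γ hN f hf) where
  smul_assoc c a b := (congrArg (· • (show SkewPoly σ ⧸ Ideal.span {f} from b))
      (map_smul (hughesLift L' hL' γ hN f hf) c a)).trans
      (smul_assoc c (hughesLift L' hL' γ hN f hf a) (show SkewPoly σ ⧸ Ideal.span {f} from b))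

instance instSMulCommClass :
    SMulCommClass K (HKAlgebra L' hL' γ hN f hf) (HKAlgebra L' hL' γ hN f hf) where
  smul_comm c a b := (smul_comm c (hughesLift L' hL' γ hN f hf a)
    (show SkewPoly σ ⧸ Ideal.span {f} from b))

variable (L' hL' γ hN f hf) in
/-- The class of a skew polynomial. -/
def mk (p : SkewPoly σ) : HKAlgebra L' hL' γ hN f hf :=
  (Submodule.Quotient.mk p : SkewPoly σ ⧸ Ideal.span {f})

/-- The explicit formula for `⋆_D`. -/
theorem mk_mul_mk (hd : 1 ≤ f.natDegree) (a₀' a₀'' : L') (a : ℕ → L) (b : SkewPoly σ) :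
    mk L' hL' γ hN f hf (SkewPoly.monomial σ 0 (a₀' + γ * a₀'')
        + ∑ i ∈ Finset.Ico 1 f.natDegree, SkewPoly.monomial σ i (a i))
      * mk L' hL' γ hN f hf b =
    mk L' hL' γ hN f hf ((SkewPoly.monomial σ 0 (a₀' + γ * a₀'')
        + ∑ i ∈ Finset.Ico 1 f.natDegree, SkewPoly.monomial σ i (a i)
        - SkewPoly.monomial σ 0 (γ / f.coeff 0 * a₀'') * f) * b) := by
  set p : SkewPoly σ := SkewPoly.monomial σ 0 (a₀' + γ * a₀'')
        + ∑ i ∈ Finset.Ico 1 f.natDegree, SkewPoly.monomial σ i (a i) with hp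
  have hcoeff : ∀ j, p.coeff j = (if 0 = j then (a₀' + γ * a₀'' : L) else 0) +
      ∑ i ∈ Finset.Ico 1 f.natDegree, if i = j then a i else 0 := by
    intro j
    rw [hp, SkewPoly.coeff_add, ← SkewPoly.lcoeff_apply (∑ i ∈ _, _), map_sum]
    simp only [SkewPoly.lcoeff_apply, SkewPoly.coeff_monomial]
  have hp0 : p.coeff 0 = a₀' + γ * a₀'' := by
    rw [hcoeff, if_pos rfl, Finset.sum_eq_zero, add_zero]
    intro i hi
    rw [Finset.mem_Ico] at hi
    rw [if_neg (by omega)]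
  have hpd : p ∈ SkewPoly.degreeLT σ f.natDegree := by
    intro j hj
    rw [hcoeff, if_neg (by omega), Finset.sum_eq_zero, add_zero]
    intro i hi
    rw [Finset.mem_Ico] at hi
    rw [if_neg (by omega)]
  have hq : f.quotientEquiv hf (Submodule.Quotient.mk p) = ⟨p, hpd⟩ := by
    rw [SkewPoly.quotientEquiv, LinearEquiv.symm_apply_eq]
    rfl
  have hl : hughesLift L' hL' γ hN f hf (Submodule.Quotient.mk p) =
      p - SkewPoly.monomial σ 0 (γ / f.coeff 0 * a₀'') * f := by
    change ((f.quotientEquiv hf (Submodule.Quotient.mk p) : SkewPoly σ)) -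
      SkewPoly.monomial σ 0 (γ / f.coeff 0 *
        ((splitEquiv L' hL' γ (notMem_of_norm_not_square L' hL' hN)).symm
          ((f.quotientEquiv hf (Submodule.Quotient.mk p) : SkewPoly σ).coeff 0)).2) * f = _
    rw [hq]
    simp only [hp0]
    rw [← splitEquiv_apply L' hL' γ (notMem_of_norm_not_square L' hL' hN) a₀' a₀'',
      LinearEquiv.symm_apply_apply]
  exact (congrArg (· • (Submodule.Quotient.mk b : SkewPoly σ ⧸ Ideal.span {f})) hl)

end HKAlgebra

end HughesKleinfeld

/-! ## The quotient `R / R F(xⁿ)` and the codes `D_{n,sℓ,k}(γ, F)` -/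

section Codes

variable [FiniteDimensional K L] [IsGalois K L]

/-- The ring `R_F = R / R F(xⁿ)`, where `n = [L : K]`. -/
abbrev SkewQuotient (σ : L ≃ₐ[K] L) (F : Polynomial K) : Type _ :=
  SkewPoly σ ⧸ Ideal.span {SkewPoly.evalXPow σ F}

/-- `E_F`, the centre of `R_F`. -/
abbrev centreEF (σ : L ≃ₐ[K] L) (F : Polynomial K) : Subalgebra K (SkewQuotient σ F) :=
  Subalgebra.center K (SkewQuotient σ F)

/-- The code `{a₀' + ∑_{1 ≤ i < N} aᵢ xⁱ + γ a₀'' x^N + R F(xⁿ) : aᵢ ∈ L, a₀', a₀'' ∈ L'}`;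
the code `D_{n,sℓ,k}(γ, F)` is the case `N = s k ℓ`. -/
def codeD (σ : L ≃ₐ[K] L) (F : Polynomial K) (L' : IntermediateField K L) (γ : L) (N : ℕ) :
    Submodule K (SkewQuotient σ F) where
  carrier := {z | ∃ (a₀' a₀'' : L') (a : ℕ → L),
    z = Ideal.Quotient.mk (Ideal.span {SkewPoly.evalXPow σ F})
      (SkewPoly.monomial σ 0 (a₀' : L) + ∑ i ∈ Finset.Ico 1 N, SkewPoly.monomial σ i (a i)
        + SkewPoly.monomial σ N (γ * a₀''))}
  add_mem' := by
    rintro _ _ ⟨a, b, c, rfl⟩ ⟨a', b', c', rfl⟩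
    refine ⟨a + a', b + b', c + c', ?_⟩
    rw [← map_add]
    congr 1
    simp only [IntermediateField.coe_add, mul_add, ← SkewPoly.lmonomial_apply, map_add,
      Pi.add_apply, Finset.sum_add_distrib]
    abel
  zero_mem' := by
    refine ⟨0, 0, 0, ?_⟩
    simp only [ZeroMemClass.coe_zero, mul_zero, ← SkewPoly.lmonomial_apply, map_zero,
      Pi.zero_apply, Finset.sum_const_zero, add_zero]
  smul_mem' := by
    rintro r _ ⟨a, b, c, rfl⟩
    refine ⟨r • a, r • b, r • c, ?_⟩
    rw [← Ideal.Quotient.mkₐ_eq_mk K, ← map_smul]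
    congr 1
    simp only [IntermediateField.coe_smul, mul_smul_comm, ← SkewPoly.lmonomial_apply, map_smul,
      Pi.smul_apply, smul_add, Finset.smul_sum]

end Codes

end SkewPolynomials

/-- `a` is a product of exactly `m` irreducible elements. -/
def IsProductOfIrreducibles {T : Type*} [Monoid T] (a : T) (m : ℕ) : Prop :=
  ∃ l : List T, l.length = m ∧ (∀ g ∈ l, Irreducible g) ∧ l.prod = a

/-! ## Nuclei of a nonassociative algebra -/

section Nuclei

variable (K A : Type*) [Field K] [NonUnitalNonAssocRing A] [Module K A]
  [IsScalarTower K A A] [SMulCommClass K A A]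

/-- The left nucleus. -/
def leftNucleus : NonUnitalSubalgebra K A where
  carrier := {a | ∀ b c : A, a * (b * c) = (a * b) * c}
  mul_mem' {x y} hx hy b c := by rw [← hx y (b * c), hy b c, ← hx y b, ← hx (y * b) c]
  add_mem' {x y} hx hy b c := by simp only [add_mul, hx b c, hy b c]
  zero_mem' b c := by simp only [zero_mul]
  smul_mem' r x hx b c := by simp only [smul_mul_assoc, hx b c]

/-- The middle nucleus. -/
def middleNucleus : NonUnitalSubalgebra K A where
  carrier := {b | ∀ a c : A, a * (b * c) = (a * b) * c}
  mul_mem' {x y} hx hy a c := by rw [← hy x c, hx a (y * c), hy (a * x) c, hx a y]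
  add_mem' {x y} hx hy a c := by simp only [add_mul, mul_add, hx a c, hy a c]
  zero_mem' a c := by simp only [zero_mul, mul_zero]
  smul_mem' r x hx a c := by simp only [smul_mul_assoc, mul_smul_comm, hx a c]

/-- The right nucleus. -/
def rightNucleus : NonUnitalSubalgebra K A where
  carrier := {c | ∀ a b : A, a * (b * c) = (a * b) * c}
  mul_mem' {x y} hx hy a b := by rw [hy b x, hy a (b * x), hx a b, ← hy (a * b) x]
  add_mem' {x y} hx hy a b := by simp only [mul_add, hx a b, hy a b]
  zero_mem' a b := by simp only [mul_zero]
  smul_mem' r x hx a b := by simp only [mul_smul_comm, hx a b]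

/-- The centre: the elements of all three nuclei that commute with every element of `A`. -/
def algebraCentre : NonUnitalSubalgebra K A where
  carrier := {a | (a ∈ leftNucleus K A ∧ a ∈ middleNucleus K A ∧ a ∈ rightNucleus K A) ∧
    ∀ b : A, a * b = b * a}
  mul_mem' {x y} hx hy := by
    refine ⟨⟨mul_mem hx.1.1 hy.1.1, mul_mem hx.1.2.1 hy.1.2.1, mul_mem hx.1.2.2 hy.1.2.2⟩,
      fun b => ?_⟩
    rw [← hx.1.1 y b, hy.2 b, hx.1.1 b y, hx.2 b, ← hx.1.2.1 b y]
  add_mem' {x y} hx hy :=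
    ⟨⟨add_mem hx.1.1 hy.1.1, add_mem hx.1.2.1 hy.1.2.1, add_mem hx.1.2.2 hy.1.2.2⟩,
      fun b => by rw [add_mul, mul_add, hx.2 b, hy.2 b]⟩
  zero_mem' := ⟨⟨zero_mem _, zero_mem _, zero_mem _⟩, fun b => by rw [zero_mul, mul_zero]⟩
  smul_mem' r x hx :=
    ⟨⟨SMulMemClass.smul_mem r hx.1.1, SMulMemClass.smul_mem r hx.1.2.1,
      SMulMemClass.smul_mem r hx.1.2.2⟩,
      fun b => by rw [smul_mul_assoc, mul_smul_comm, hx.2 b]⟩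

/-- Isomorphism of (possibly nonassociative, possibly nonunital) `K`-algebras. -/
def NonassocAlgIso (K A B : Type*) [Field K] [NonUnitalNonAssocRing A] [Module K A]
    [NonUnitalNonAssocRing B] [Module K B] : Prop :=
  ∃ e : A ≃ₗ[K] B, ∀ x y : A, e (x * y) = e x * e y

end Nuclei

/-! ## Idealisers, centraliser and centre of a code -/

section Idealisers

variable {K T : Type*} [Field K] [Ring T] [Algebra K T]

/-- The left idealiser `{A : A C ⊆ C}`. -/
def leftIdealiser (C : Submodule K T) : Subalgebra K T where
  carrier := {A | ∀ X ∈ C, A * X ∈ C}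
  mul_mem' {a b} ha hb X hX := by rw [mul_assoc]; exact ha _ (hb X hX)
  add_mem' {a b} ha hb X hX := by rw [add_mul]; exact add_mem (ha X hX) (hb X hX)
  algebraMap_mem' r X hX := by rw [← Algebra.smul_def]; exact C.smul_mem r hX

/-- The right idealiser `{B : C B ⊆ C}`. -/
def rightIdealiser (C : Submodule K T) : Subalgebra K T where
  carrier := {B | ∀ X ∈ C, X * B ∈ C}
  mul_mem' {a b} ha hb X hX := by rw [← mul_assoc]; exact hb _ (ha X hX)
  add_mem' {a b} ha hb X hX := by rw [mul_add]; exact add_mem (ha X hX) (hb X hX)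
  algebraMap_mem' r X hX := by
    rw [← Algebra.commutes, ← Algebra.smul_def]; exact C.smul_mem r hX

/-- The centraliser: the elements commuting with every codeword. -/
def codeCentraliser (C : Submodule K T) : Subalgebra K T := Subalgebra.centralizer K (C : Set T)

/-- The centre of the code: the intersection of the left idealiser and the centraliser. -/
def codeCentre (C : Submodule K T) : Subalgebra K T := leftIdealiser C ⊓ codeCentraliser C

end Idealisers

end

/-! Both parts rest on one set of skew polynomials, `IsCodePoly L' δ N`: degree at most `N`,
constant coefficient in `L'`, coefficient of `x ^ N` in `δ L'`. The code `D` is its image in `R_F`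
with `δ = γ` and `N = skℓ`. In `R / Rf`, take `δ = γ / f₀` and `N = deg f`: subtracting `(γ / f₀)
a₀'' f` removes `γ a₀''` from the constant term and creates the top coefficient `-(γ / f₀) a₀''`. So
every class has a representative `p` of this shape, and left multiplication by the class is the
module action of `p` (`mk_mul`).

The code idealisers and the left and middle nuclei ask which `p` in the set keep `p c x ^ j`,
respectively `c x ^ j p`, in the set for all `c` and `1 ≤ j < N`. Degree and leading coefficient
show that only the constants in `L'` qualify (`IsCodePoly.eq_monomial_zero_of_mul`,
`IsCodePoly.eq_monomial_zero_of_monomial_mul`). Conversely they do qualify, on the right because `σ`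
preserves `L'`.

This needs identities in the quotient to lift to identities of polynomials. The products have degree
below `2N`. For the code, `2N ≤ ns = deg F(xⁿ)`. For the nuclei, `R / Rf` has no nonzero annihilator
of degree below `2 deg f` when `f` is irreducible and not central (`eq_zero_of_annihilates`).

The centraliser and the right nucleus come from generation: the set contains `x` and all `c x`, and
`x` is invertible in `R_F`, respectively acts surjectively on `R / Rf`, which recovers the
constants. Hence the centraliser is the centre of `R_F`, and the right nucleus is the endomorphism
ring of `R / Rf`, that is, the eigenring. Both centres consist of constants commuting with `x`;
these are fixed by `σ`, so they lie in `K`. -/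

noncomputable section
variable {K L : Type*} [Field K] [Field L] [Algebra K L] {σ : L ≃ₐ[K] L}

namespace SkewPoly

/-! ### Products with monomials and constants -/

theorem coeff_zero (i : ℕ) : (0 : SkewPoly σ).coeff i = 0 := rfl

theorem monomial_mul_coeff (a : L) (i j k : ℕ) (p : SkewPoly σ) (hk : k = i + j) :
    (monomial σ i a * p).coeff k = a * (σ ^ i) (p.coeff j) := by
  obtain ⟨N, hN⟩ := exists_bound p
  rw [coeff_mul (M := i + 1) (N := N) (fun k hk => by rw [coeff_monomial, if_neg (by omega)]) hN]
  rw [Finset.sum_eq_single i]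
  · rw [Finset.sum_eq_single j]
    · rw [if_pos hk.symm, coeff_monomial, if_pos rfl]
    · intro b _ hb; rw [if_neg (by omega)]
    · intro h
      rw [Finset.mem_range, not_lt] at h
      rw [hN j h]; simp
  · intro b _ hb
    refine Finset.sum_eq_zero fun c _ => ?_
    rw [coeff_monomial, if_neg (Ne.symm hb)]; simp
  · simp

theorem coeff_mul_monomial (a : L) (i j k : ℕ) (p : SkewPoly σ) (hk : k = i + j) :
    (p * monomial σ j a).coeff k = p.coeff i * (σ ^ i) a := by
  obtain ⟨N, hN⟩ := exists_bound p
  rw [coeff_mul (M := N) (N := j + 1) hN (fun k hk => by rw [coeff_monomial, if_neg (by omega)])]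
  rw [Finset.sum_eq_single i]
  · rw [Finset.sum_eq_single j]
    · rw [if_pos hk.symm, coeff_monomial, if_pos rfl]
    · intro b _ hb; rw [if_neg (by omega)]
    · simp
  · intro b _ hb
    refine Finset.sum_eq_zero fun c _ => ?_
    rw [coeff_monomial]
    split_ifs
    · omega
    all_goals simp
  · intro h
    rw [Finset.mem_range, not_lt] at h
    simp [hN i h]

theorem monomial_zero_mul_coeff (a : L) (p : SkewPoly σ) (i : ℕ) :
    (monomial σ 0 a * p).coeff i = a * p.coeff i :=
  monomial_mul_coeff a 0 i i p (zero_add i).symm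

theorem coeff_mul_monomial_zero (a : L) (p : SkewPoly σ) (i : ℕ) :
    (p * monomial σ 0 a).coeff i = p.coeff i * (σ ^ i) a :=
  coeff_mul_monomial a i 0 i p rfl

theorem monomial_eq_mul_X_pow (i : ℕ) (a : L) : monomial σ i a = monomial σ 0 a * X σ ^ i := by
  rw [X_pow, monomial_mul_monomial, zero_add, map_one, mul_one]

theorem algebraMap_eq_monomial (c : K) :
    algebraMap K (SkewPoly σ) c = monomial σ 0 (algebraMap K L c) := by
  rw [Algebra.algebraMap_eq_smul_one, one_def, ← lmonomial_apply, ← lmonomial_apply, ← map_smul,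
    Algebra.algebraMap_eq_smul_one]

/-- A property stable under sums and products that holds for constants and for `x` holds for
all skew polynomials. -/
theorem induction_mul {P : SkewPoly σ → Prop} (hadd : ∀ p q, P p → P q → P (p + q))
    (hmul : ∀ p q, P p → P q → P (p * q)) (hconst : ∀ a, P (monomial σ 0 a)) (hX : P (X σ))
    (p : SkewPoly σ) : P p := by
  have hpow : ∀ i, P (X σ ^ i) := by
    intro i
    induction i with
    | zero => exact hconst 1
    | succ i ih => rw [pow_succ]; exact hmul _ _ ih hX
  obtain ⟨N, hN⟩ := exists_bound p
  rw [eq_sum_monomial hN]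
  refine Finset.sum_induction _ P hadd ?_ fun i _ => ?_
  · have := hconst 0
    rwa [← lmonomial_apply, map_zero] at this
  · rw [monomial_eq_mul_X_pow]
    exact hmul _ _ (hconst _) (hpow i)

/-! ### Degrees -/

theorem coeff_natDegree_ne_zero {p : SkewPoly σ} (hp : p ≠ 0) : p.coeff p.natDegree ≠ 0 := by
  have hne : (SkewPolynomial.support p).Nonempty := by
    by_contra h
    rw [Finset.not_nonempty_iff_eq_empty] at h
    apply hp
    ext i
    by_contra hi
    have : i ∈ SkewPolynomial.support p := SkewPolynomial.mem_support_iff.2 hi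
    rw [h] at this
    simp at this
  obtain ⟨i, hi, h⟩ := Finset.exists_mem_eq_sup _ hne id
  rw [natDegree, h]
  exact SkewPolynomial.mem_support_iff.1 hi

theorem natDegree_le {p : SkewPoly σ} {N : ℕ} (h : ∀ i, N < i → p.coeff i = 0) :
    p.natDegree ≤ N := by
  by_contra hlt
  rw [not_le] at hlt
  have hp : p ≠ 0 := by
    rintro rfl
    have : (0 : SkewPoly σ).natDegree = 0 := rfl
    omega
  exact coeff_natDegree_ne_zero hp (h _ hlt)

theorem le_natDegree {p : SkewPoly σ} {i : ℕ} (h : p.coeff i ≠ 0) : i ≤ p.natDegree := by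
  by_contra hlt
  exact h (coeff_eq_zero_of_natDegree_lt p (not_le.1 hlt))

theorem Monic.ne_zero {p : SkewPoly σ} (hp : p.Monic) : p ≠ 0 := by
  rintro rfl
  exact zero_ne_one hp

theorem coeff_mul_natDegree (p q : SkewPoly σ) :
    (p * q).coeff (p.natDegree + q.natDegree) =
      p.coeff p.natDegree * (σ ^ p.natDegree) (q.coeff q.natDegree) :=
  coeff_mul_top (fun _ h => coeff_eq_zero_of_natDegree_lt p h)
    (fun _ h => coeff_eq_zero_of_natDegree_lt q h)

theorem natDegree_mul {p q : SkewPoly σ} (hp : p ≠ 0) (hq : q ≠ 0) :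
    (p * q).natDegree = p.natDegree + q.natDegree := by
  refine le_antisymm (natDegree_le fun i hi => ?_) (le_natDegree ?_)
  · exact coeff_mul_eq_zero (fun _ h => coeff_eq_zero_of_natDegree_lt p h)
      (fun _ h => coeff_eq_zero_of_natDegree_lt q h) hi
  · rw [coeff_mul_natDegree]
    refine mul_ne_zero (coeff_natDegree_ne_zero hp) ?_
    rw [Ne, EmbeddingLike.map_eq_zero_iff]
    exact coeff_natDegree_ne_zero hq

instance instNoZeroDivisors : NoZeroDivisors (SkewPoly σ) where
  eq_zero_or_eq_zero_of_mul_eq_zero {p q} h := by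
    by_contra! hne
    have h1 := coeff_mul_natDegree p q
    rw [h, coeff_zero] at h1
    refine mul_ne_zero (coeff_natDegree_ne_zero hne.1) ?_ h1.symm
    rw [Ne, EmbeddingLike.map_eq_zero_iff]
    exact coeff_natDegree_ne_zero hne.2

instance instNontrivial : Nontrivial (SkewPoly σ) :=
  ⟨⟨0, 1, fun h => zero_ne_one (α := L) (by
    have := congrArg (fun p => p.coeff 0) h
    simpa only [coeff_zero, one_def, coeff_monomial, if_pos] using this)⟩⟩

theorem natDegree_eq_zero_of_isUnit {p : SkewPoly σ} (hp : IsUnit p) : p.natDegree = 0 := by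
  obtain ⟨u, rfl⟩ := hp
  have h := natDegree_mul (σ := σ) u.ne_zero u⁻¹.ne_zero
  rw [Units.mul_inv] at h
  have : (1 : SkewPoly σ).natDegree ≤ 0 := natDegree_le fun i hi => by
    rw [one_def, coeff_monomial, if_neg (by omega)]
  omega

theorem eq_monomial_of_natDegree_eq_zero {p : SkewPoly σ} (hp : p.natDegree = 0) :
    p = monomial σ 0 (p.coeff 0) := by
  ext i
  rw [coeff_monomial]
  split_ifs with h
  · rw [h]
  · exact coeff_eq_zero_of_natDegree_lt p (by omega)

theorem natDegree_X : (X σ).natDegree = 1 := by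
  refine le_antisymm (natDegree_le fun i hi => ?_) (le_natDegree ?_)
  · rw [X, coeff_monomial, if_neg (by omega)]
  · rw [X, coeff_monomial, if_pos rfl]; exact one_ne_zero

theorem coeff_zero_mul (p q : SkewPoly σ) : (p * q).coeff 0 = p.coeff 0 * q.coeff 0 := by
  obtain ⟨M, hM⟩ := exists_bound p
  obtain ⟨N, hN⟩ := exists_bound q
  rw [coeff_mul (M := M + 1) (N := N + 1) (fun i hi => hM i (by omega))
    (fun i hi => hN i (by omega)), Finset.sum_eq_single 0, Finset.sum_eq_single 0]
  · simp
  · intro b _ hb; rw [if_neg (by omega)]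
  · simp
  · intro b _ hb
    exact Finset.sum_eq_zero fun c _ => if_neg (by omega)
  · simp

/-- Splitting off the constant term. -/
theorem exists_eq_mul_X_add (p : SkewPoly σ) :
    ∃ q : SkewPoly σ, p = q * X σ + monomial σ 0 (p.coeff 0) := by
  obtain ⟨N, hN⟩ := exists_bound p
  refine ⟨∑ i ∈ Finset.range N, monomial σ i (p.coeff (i + 1)), ?_⟩
  conv_lhs => rw [eq_sum_monomial (N := N + 1) fun i hi => hN i (by omega)]
  rw [Finset.sum_range_succ', Finset.sum_mul]
  congr 1
  refine Finset.sum_congr rfl fun i _ => ?_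
  rw [X, monomial_mul_monomial, map_one, mul_one]

/-- Invertibility of `σ` lets `x` move to the left: `a x = x σ⁻¹(a)`. -/
theorem exists_mul_X_eq_X_mul (p : SkewPoly σ) : ∃ q, p * X σ = X σ * q := by
  refine induction_mul (P := fun p => ∃ q, p * X σ = X σ * q) ?_ ?_ ?_ ⟨_, rfl⟩ p
  · rintro p q ⟨p', hp⟩ ⟨q', hq⟩
    exact ⟨p' + q', by rw [add_mul, hp, hq, mul_add]⟩
  · rintro p q ⟨p', hp⟩ ⟨q', hq⟩
    exact ⟨p' * q', by rw [mul_assoc, hq, ← mul_assoc, hp, mul_assoc]⟩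
  · intro a
    exact ⟨monomial σ 0 (σ.symm a), by rw [X_mul_monomial_zero, AlgEquiv.apply_symm_apply]⟩

/-! ### Division and dimension -/

theorem exists_monomial_mul_monic {p : SkewPoly σ} (hp : p ≠ 0) :
    ∃ c : L, c ≠ 0 ∧ (monomial σ 0 c * p).Monic ∧
      (monomial σ 0 c * p).natDegree = p.natDegree := by
  have h0 := coeff_natDegree_ne_zero hp
  have hd : (monomial σ 0 (p.coeff p.natDegree)⁻¹ * p).natDegree = p.natDegree := by
    refine le_antisymm (natDegree_le fun i hi => ?_) (le_natDegree ?_)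
    · rw [monomial_zero_mul_coeff, coeff_eq_zero_of_natDegree_lt p hi, mul_zero]
    · rw [monomial_zero_mul_coeff, inv_mul_cancel₀ h0]; exact one_ne_zero
  refine ⟨(p.coeff p.natDegree)⁻¹, inv_ne_zero h0, ?_, hd⟩
  rw [Monic, hd, monomial_zero_mul_coeff, inv_mul_cancel₀ h0]

theorem exists_mul_add_of_monic {g : SkewPoly σ} (hg : g.Monic) (p : SkewPoly σ) :
    ∃ q r : SkewPoly σ, p = q * g + r ∧ ∀ i, g.natDegree ≤ i → r.coeff i = 0 := by
  obtain ⟨⟨r, hr⟩, h⟩ := (degreeLTToQuotient_bijective hg).2 (Submodule.Quotient.mk p)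
  have h' : r - p ∈ Ideal.span {g} := (Submodule.Quotient.eq _).1 h
  obtain ⟨q, hq⟩ := Ideal.mem_span_singleton'.1 h'
  exact ⟨-q, r, by rw [neg_mul, hq]; abel, hr⟩

theorem eq_zero_of_mem_span_of_lt {g r : SkewPoly σ} (hr : r ∈ Ideal.span {g})
    (hd : ∀ i, g.natDegree ≤ i → r.coeff i = 0) : r = 0 := by
  obtain ⟨q, rfl⟩ := Ideal.mem_span_singleton'.1 hr
  by_contra hne
  have h := natDegree_mul (left_ne_zero_of_mul hne) (right_ne_zero_of_mul hne)
  exact coeff_natDegree_ne_zero hne (hd _ (by omega))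

/-- Left ideals of `L[x; σ]` are principal. -/
theorem exists_span_singleton_eq (I : Ideal (SkewPoly σ)) : ∃ g, I = Ideal.span {g} := by
  by_cases hI : ∃ p ∈ I, p ≠ 0
  · classical
    -- A monic element of least degree generates: a nonzero remainder, rescaled to be monic, would
    -- have smaller degree.
    have hex : ∃ d, ∃ p ∈ I, p.Monic ∧ p.natDegree = d := by
      obtain ⟨p, hp, h0⟩ := hI
      obtain ⟨c, -, hm, hd⟩ := exists_monomial_mul_monic h0
      exact ⟨_, _, I.mul_mem_left _ hp, hm, rfl⟩
    obtain ⟨g, hgI, hgm, hgd⟩ := Nat.find_spec hex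
    refine ⟨g, le_antisymm (fun p hp => ?_) ((Ideal.span_singleton_le_iff_mem I).2 hgI)⟩
    obtain ⟨q, r, hqr, hr⟩ := exists_mul_add_of_monic hgm p
    have hrI : r ∈ I := by
      have : r = p - q * g := by rw [hqr]; abel
      rw [this]
      exact I.sub_mem hp (I.mul_mem_left _ hgI)
    have hr0 : r = 0 := by
      by_contra h0
      obtain ⟨c, -, hm, hd⟩ := exists_monomial_mul_monic h0
      have h1 := Nat.find_min' hex ⟨_, I.mul_mem_left _ hrI, hm, rfl⟩
      have h2 : r.natDegree < g.natDegree := by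
        by_contra hle
        exact coeff_natDegree_ne_zero h0 (hr _ (not_lt.1 hle))
      omega
    rw [hqr, hr0, add_zero]
    exact Ideal.mem_span_singleton'.2 ⟨q, rfl⟩
  · push Not at hI
    exact ⟨0, by
      rw [Ideal.span_singleton_zero]
      exact (Submodule.eq_bot_iff I).2 hI⟩

/-- For irreducible `f`, every nonzero class generates `R / Rf`. -/
theorem exists_mul_sub_mem_span {f p : SkewPoly σ} (hf : Irreducible f) (hp : p ∉ Ideal.span {f})
    (q : SkewPoly σ) : ∃ r, r * p - q ∈ Ideal.span {f} := by
  obtain ⟨g, hg⟩ := exists_span_singleton_eq (Ideal.span {f, p})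
  have hfg : f ∈ Ideal.span {g} := hg ▸ Ideal.subset_span (by simp)
  have hpg : p ∈ Ideal.span {g} := hg ▸ Ideal.subset_span (by simp)
  obtain ⟨h, hh⟩ := Ideal.mem_span_singleton'.1 hfg
  obtain ⟨s, hs⟩ := Ideal.mem_span_singleton'.1 hpg
  -- Here `f = h g`. If `h` is a unit then `g ∈ Rf`, which forces `p ∈ Rf`; if `g` is a unit then
  -- `Rf + Rp = R`.
  rcases hf.isUnit_or_isUnit hh.symm with hu | hu
  · exfalso
    obtain ⟨u, rfl⟩ := hu
    apply hp
    refine Ideal.mem_span_singleton'.2 ⟨s * ↑u⁻¹, ?_⟩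
    rw [← hh, mul_assoc, Units.inv_mul_cancel_left, hs]
  · have : q ∈ Ideal.span {f, p} := by
      rw [hg]
      obtain ⟨u, rfl⟩ := hu
      exact Ideal.mem_span_singleton'.2 ⟨q * ↑u⁻¹, by rw [Units.inv_mul_cancel_right]⟩
    obtain ⟨a, b, hab⟩ := Ideal.mem_span_pair.1 this
    exact ⟨b, Ideal.mem_span_singleton'.2 ⟨-a, by rw [← hab, neg_mul]; abel⟩⟩

/-- A vanishing constant term would make `x` a right factor, and irreducibility would then force
degree one. -/
theorem coeff_zero_ne_zero {f : SkewPoly σ} (hfi : Irreducible f) (hd : 2 ≤ f.natDegree) :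
    f.coeff 0 ≠ 0 := by
  intro h0
  obtain ⟨q, hq⟩ := exists_eq_mul_X_add f
  rw [h0, ← lmonomial_apply, map_zero, add_zero] at hq
  have hne := hfi.ne_zero
  rw [hq] at hne
  have hdeg := natDegree_mul (left_ne_zero_of_mul hne) (right_ne_zero_of_mul hne)
  rw [← hq, natDegree_X] at hdeg
  rcases hfi.isUnit_or_isUnit hq with hu | hu
  · have := natDegree_eq_zero_of_isUnit hu
    omega
  · have := natDegree_eq_zero_of_isUnit hu
    rw [natDegree_X] at this
    omega

/-- If `f` has nonzero constant term and `Rf` is a two-sided ideal, then `f` is central. -/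
theorem mem_center_of_mul_mem_span {f : SkewPoly σ} (hf : f.Monic) (h0 : f.coeff 0 ≠ 0)
    (h : ∀ p, f * p ∈ Ideal.span {f}) : f ∈ Subalgebra.center K (SkewPoly σ) := by
  -- By degrees `f a = b f` with `b` constant; comparing constant terms, `f₀ a = b f₀`, so `b = a`.
  have hc : ∀ a, f * monomial σ 0 a = monomial σ 0 a * f := by
    intro a
    by_cases ha : monomial σ 0 a = 0
    · rw [ha, mul_zero, zero_mul]
    obtain ⟨q, hq⟩ := Ideal.mem_span_singleton'.1 (h (monomial σ 0 a))
    have hne : q * f ≠ 0 := by rw [hq]; exact mul_ne_zero hf.ne_zero ha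
    have h1 := natDegree_mul hf.ne_zero ha
    rw [← hq, natDegree_mul (left_ne_zero_of_mul hne) hf.ne_zero,
      Nat.le_zero.1 (natDegree_le (p := monomial σ 0 a) (N := 0)
        fun i hi => by rw [coeff_monomial, if_neg (by omega)])] at h1
    have h2 := eq_monomial_of_natDegree_eq_zero (p := q) (by omega)
    have h3 := congrArg (fun p => p.coeff 0) hq
    simp only [coeff_zero_mul, coeff_monomial, if_pos] at h3
    rw [mul_comm] at h3
    rw [← hq, h2, mul_left_cancel₀ h0 h3]
  -- By degrees `f x = q f` with `deg q = 1`. The constant terms give `q₀ f₀ = 0`, hence `q₀ = 0`;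
  -- the leading ones give `q₁ = 1`.
  have hX : f * X σ = X σ * f := by
    obtain ⟨q, hq⟩ := Ideal.mem_span_singleton'.1 (h (X σ))
    have hX0 : X σ ≠ 0 := fun hX0 => by
      have := natDegree_X (σ := σ)
      rw [hX0] at this
      exact zero_ne_one this
    have hne : q * f ≠ 0 := by rw [hq]; exact mul_ne_zero hf.ne_zero hX0
    have h1 := natDegree_mul hf.ne_zero hX0
    rw [← hq, natDegree_mul (left_ne_zero_of_mul hne) hf.ne_zero, natDegree_X] at h1
    have hq1 : q.natDegree = 1 := by omega
    have h3 := congrArg (fun p => p.coeff 0) hq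
    simp only [coeff_zero_mul, X, coeff_monomial] at h3
    rw [if_neg (by omega), mul_zero, mul_eq_zero, or_iff_left h0] at h3
    have h4 := coeff_mul_natDegree q f
    rw [hq, hq1, show f.coeff f.natDegree = 1 from hf, map_one, mul_one, X,
      coeff_mul_monomial 1 f.natDegree 1 _ f (add_comm _ _), map_one, mul_one,
      show f.coeff f.natDegree = 1 from hf] at h4
    have h5 : q = X σ := by
      ext i
      rw [X, coeff_monomial]
      split_ifs with hi
      · rw [← hi, ← h4]
      · rcases Nat.eq_zero_or_pos i with rfl | hi'
        · exact h3
        · exact coeff_eq_zero_of_natDegree_lt q (by omega)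
    rw [← hq, h5]
  rw [Subalgebra.mem_center_iff]
  intro p
  refine induction_mul (P := fun p => p * f = f * p) ?_ ?_ (fun a => (hc a).symm) hX.symm p
  · intro p q hp hq
    rw [add_mul, hp, hq, mul_add]
  · intro p q hp hq
    rw [mul_assoc, hq, ← mul_assoc, hp, mul_assoc]

variable (σ) in
/-- Skew polynomials of degree less than `d` correspond to their coefficient vectors. -/
def degreeLTEquiv (d : ℕ) : degreeLT σ d ≃ₗ[K] (Fin d → L) where
  toFun p i := (p : SkewPoly σ).coeff i
  map_add' p q := funext fun i => coeff_add _ _ _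
  map_smul' c p := funext fun i => map_smul (lcoeff σ (i : ℕ)) c (p : SkewPoly σ)
  invFun v := ⟨∑ i : Fin d, lmonomial σ (i : ℕ) (v i), fun j hj => by
    rw [← lcoeff_apply, map_sum]
    refine Finset.sum_eq_zero fun i _ => ?_
    rw [lmonomial_apply, lcoeff_apply, coeff_monomial, if_neg (by omega)]⟩
  left_inv p := by
    apply Subtype.ext
    change ∑ i : Fin d, monomial σ (i : ℕ) ((p : SkewPoly σ).coeff i) = p
    rw [Fin.sum_univ_eq_sum_range (fun i => monomial σ i ((p : SkewPoly σ).coeff i))]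
    exact (eq_sum_monomial p.2).symm
  right_inv v := by
    funext j
    change (∑ i : Fin d, monomial σ (i : ℕ) (v i)).coeff j = v j
    rw [← lcoeff_apply, map_sum, Finset.sum_eq_single j]
    · rw [lcoeff_apply, coeff_monomial, if_pos rfl]
    · intro i _ hi
      rw [lcoeff_apply, coeff_monomial, if_neg (fun h => hi (Fin.ext h))]
    · simp

variable [FiniteDimensional K L]

theorem finrank_degreeLT (d : ℕ) :
    Module.finrank K (degreeLT σ d) = d * Module.finrank K L := by
  rw [(degreeLTEquiv σ d).finrank_eq, Module.finrank_pi_fintype]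
  simp

instance instFiniteDegreeLT (d : ℕ) : FiniteDimensional K (degreeLT σ d) :=
  Module.Finite.equiv (degreeLTEquiv σ d).symm

/-- A nonzero skew polynomial of degree less than `deg f` acts injectively on `R / Rf`. -/
theorem natDegree_le_of_mul_mem_span {f u p : SkewPoly σ} (hf : f.Monic) (hfi : Irreducible f)
    (hp : p ∉ Ideal.span {f}) (hu : u ≠ 0) (h : u * p ∈ Ideal.span {f}) :
    f.natDegree ≤ u.natDegree := by
  obtain ⟨c, hc, hm, hd⟩ := exists_monomial_mul_monic hu
  set g := monomial σ 0 c * u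
  have hg : g * p ∈ Ideal.span {f} := by
    rw [mul_assoc]; exact Ideal.mul_mem_left _ _ h
  -- The map `s ↦ s p mod Rf` on remainders modulo `g`. It is onto because the class of `p`
  -- generates `R / Rf` and `g` kills it, so comparing dimensions over `K` gives `deg f ≤ deg g`.
  let T : degreeLT σ g.natDegree →ₗ[K] degreeLT σ f.natDegree :=
    (quotientEquiv f hf).toLinearMap ∘ₗ ((Ideal.span {f}).mkQ.restrictScalars K) ∘ₗ
      (LinearMap.mulRight K p) ∘ₗ (degreeLT σ g.natDegree).subtype
  have hT : Function.Surjective T := by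
    intro z
    obtain ⟨r, hr⟩ := exists_mul_sub_mem_span hfi hp (z : SkewPoly σ)
    obtain ⟨q, s, hqs, hs⟩ := exists_mul_add_of_monic hm r
    refine ⟨⟨s, hs⟩, ?_⟩
    change quotientEquiv f hf (Submodule.Quotient.mk (s * p)) = z
    rw [← LinearEquiv.eq_symm_apply]
    change _ = (Submodule.Quotient.mk (z : SkewPoly σ) : SkewPoly σ ⧸ Ideal.span {f})
    rw [Submodule.Quotient.eq]
    have : s * p - z = (r * p - z) - q * (g * p) := by rw [hqs, add_mul, mul_assoc]; abel
    rw [this]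
    exact sub_mem hr (Ideal.mul_mem_left _ _ hg)
  have hle := LinearMap.finrank_le_finrank_of_surjective (f := T) hT
  rw [finrank_degreeLT, finrank_degreeLT, hd] at hle
  exact Nat.le_of_mul_le_mul_right hle Module.finrank_pos

/-- For irreducible non-central `f`, a nonzero annihilator of `R / Rf` has degree at least
`2 deg f`. -/
theorem eq_zero_of_annihilates {f r : SkewPoly σ} (hf : f.Monic) (hfi : Irreducible f)
    (hd : 2 ≤ f.natDegree) (hfc : f ∉ Subalgebra.center K (SkewPoly σ))
    (hr : ∀ p, r * p ∈ Ideal.span {f}) (hrd : ∀ i, 2 * f.natDegree ≤ i → r.coeff i = 0) :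
    r = 0 := by
  by_contra hne
  -- Otherwise `Rf` is two-sided and `f` is central.
  have hex : ∃ p, f * p ∉ Ideal.span {f} := by
    by_contra! h
    exact hfc (mem_center_of_mul_mem_span hf (coeff_zero_ne_zero hfi hd) h)
  obtain ⟨p, hp⟩ := hex
  -- Write `r = u f`. Then `u` kills the nonzero class of `f p`, so `deg u ≥ deg f` and `deg r ≥ 2
  -- deg f`.
  obtain ⟨u, hu⟩ := Ideal.mem_span_singleton'.1 (show r ∈ Ideal.span {f} by simpa using hr 1)
  have hu0 : u ≠ 0 := by rintro rfl; exact hne (by rw [← hu, zero_mul])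
  have h1 := natDegree_le_of_mul_mem_span hf hfi hp hu0 (by rw [← mul_assoc, hu]; exact hr p)
  have h2 := natDegree_mul hu0 hf.ne_zero
  rw [hu] at h2
  exact coeff_natDegree_ne_zero hne (hrd _ (by omega))

end SkewPoly
end

/-! ### Code polynomials and the constants in `L'` -/

noncomputable section
variable {K L : Type*} [Field K] [Field L] [Algebra K L] {σ : L ≃ₐ[K] L}
  {L' : IntermediateField K L} {δ : L} {N : ℕ}

namespace SkewPoly

/-- The skew polynomials `∑_{i ≤ N} aᵢ xⁱ` with `a₀ ∈ L'` and `a_N ∈ δ L'`. -/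
structure IsCodePoly (L' : IntermediateField K L) (δ : L) (N : ℕ) (p : SkewPoly σ) : Prop where
  coeff_zero_mem : p.coeff 0 ∈ L'
  coeff_top : ∃ b ∈ L', p.coeff N = δ * b
  coeff_eq_zero : ∀ i, N < i → p.coeff i = 0

theorem isCodePoly_monomial_zero (hN : 1 ≤ N) (a : L') :
    IsCodePoly L' δ N (monomial σ 0 (a : L)) where
  coeff_zero_mem := by rw [coeff_monomial, if_pos rfl]; exact a.2
  coeff_top := ⟨0, zero_mem _, by rw [coeff_monomial, if_neg (by omega), mul_zero]⟩
  coeff_eq_zero i hi := by rw [coeff_monomial, if_neg (by omega)]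

theorem isCodePoly_monomial {j : ℕ} (hj : 1 ≤ j) (hjN : j < N) (c : L) :
    IsCodePoly L' δ N (monomial σ j c) where
  coeff_zero_mem := by rw [coeff_monomial, if_neg (by omega)]; exact zero_mem _
  coeff_top := ⟨0, zero_mem _, by rw [coeff_monomial, if_neg (by omega), mul_zero]⟩
  coeff_eq_zero i hi := by rw [coeff_monomial, if_neg (by omega)]

theorem IsCodePoly.monomial_zero_mul {p : SkewPoly σ} (hp : IsCodePoly L' δ N p) (a : L') :
    IsCodePoly L' δ N (monomial σ 0 (a : L) * p) where
  coeff_zero_mem := by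
    rw [monomial_zero_mul_coeff]; exact mul_mem a.2 hp.coeff_zero_mem
  coeff_top := by
    obtain ⟨b, hb, h⟩ := hp.coeff_top
    exact ⟨a * b, mul_mem a.2 hb, by rw [monomial_zero_mul_coeff, h, mul_left_comm]⟩
  coeff_eq_zero i hi := by rw [monomial_zero_mul_coeff, hp.coeff_eq_zero i hi, mul_zero]

theorem IsCodePoly.mul_monomial_zero {p : SkewPoly σ} (hp : IsCodePoly L' δ N p) (a : L')
    (hL : ∀ i, (σ ^ i) (a : L) ∈ L') : IsCodePoly L' δ N (p * monomial σ 0 (a : L)) where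
  coeff_zero_mem := by
    rw [coeff_mul_monomial_zero]; exact mul_mem hp.coeff_zero_mem (hL 0)
  coeff_top := by
    obtain ⟨b, hb, h⟩ := hp.coeff_top
    exact ⟨b * (σ ^ N) a, mul_mem hb (hL N), by rw [coeff_mul_monomial_zero, h, mul_assoc]⟩
  coeff_eq_zero i hi := by rw [coeff_mul_monomial_zero, hp.coeff_eq_zero i hi, zero_mul]

theorem IsCodePoly.natDegree_le {p : SkewPoly σ} (hp : IsCodePoly L' δ N p) :
    p.natDegree ≤ N := SkewPoly.natDegree_le hp.coeff_eq_zero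

/-- The bound `N + j < 2N` is what allows the product to be recovered from its class in `R_F` or
from its action on `R / Rf`. -/
theorem IsCodePoly.mul_monomial_coeff_eq_zero {p : SkewPoly σ} (hp : IsCodePoly L' δ N p)
    {i j : ℕ} {c : L} (hj : j < N) (hi : 2 * N ≤ i) : (p * monomial σ j c).coeff i = 0 :=
  coeff_mul_eq_zero hp.coeff_eq_zero
    (fun k (hk : j < k) => by rw [coeff_monomial, if_neg (by omega)]) (by omega)

theorem IsCodePoly.monomial_mul_coeff_eq_zero {p : SkewPoly σ} (hp : IsCodePoly L' δ N p)
    {i j : ℕ} {c : L} (hj : j < N) (hi : 2 * N ≤ i) : (monomial σ j c * p).coeff i = 0 :=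
  coeff_mul_eq_zero (fun k (hk : j < k) => by rw [coeff_monomial, if_neg (by omega)])
    hp.coeff_eq_zero (by omega)

/-- If `deg p = N`, then `p x` has degree `N + 1`; the multiplier `x` is available because `N ≥ 2`.
If `0 < deg p < N`, some `c x ^ (N - deg p)` moves the leading coefficient to position `N` with
value `δ e`, which is not in `δ L'`. -/
theorem IsCodePoly.eq_monomial_zero_of_mul {p : SkewPoly σ} (hp : IsCodePoly L' δ N p)
    (hN : 2 ≤ N) (hδ : δ ≠ 0) {e : L} (he : e ∉ L')
    (h : ∀ j c, 1 ≤ j → j < N → IsCodePoly L' δ N (p * monomial σ j c)) :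
    ∃ a : L', p = monomial σ 0 (a : L) := by
  rcases Nat.eq_zero_or_pos p.natDegree with h0 | h0
  · exact ⟨⟨_, hp.coeff_zero_mem⟩, eq_monomial_of_natDegree_eq_zero h0⟩
  exfalso
  have hp0 : p ≠ 0 := by rintro rfl; exact absurd h0 (lt_irrefl 0)
  have hl := coeff_natDegree_ne_zero hp0
  rcases hp.natDegree_le.eq_or_lt with hd | hd
  · have h1 := (h 1 1 le_rfl hN).coeff_eq_zero (N + 1) (by omega)
    rw [coeff_mul_monomial 1 N 1 _ p rfl, map_one, mul_one, ← hd] at h1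
    exact hl h1
  -- The coefficient `c` is twisted by `σ ^ deg p` when it passes `x ^ deg p`, hence the inverse in
  -- the witness.
  · obtain ⟨b, hb, h1⟩ := (h (N - p.natDegree)
      ((σ ^ p.natDegree).symm (δ * e / p.coeff p.natDegree)) (by omega) (by omega)).coeff_top
    rw [coeff_mul_monomial _ p.natDegree (N - p.natDegree) _ p (by omega),
      AlgEquiv.apply_symm_apply, mul_div_cancel₀ _ hl] at h1
    exact he (mul_left_cancel₀ hδ h1 ▸ hb)

theorem IsCodePoly.eq_monomial_zero_of_monomial_mul {p : SkewPoly σ}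
    (hp : IsCodePoly L' δ N p) (hN : 2 ≤ N) (hδ : δ ≠ 0) {e : L} (he : e ∉ L')
    (h : ∀ j c, 1 ≤ j → j < N → IsCodePoly L' δ N (monomial σ j c * p)) :
    ∃ a : L', p = monomial σ 0 (a : L) := by
  rcases Nat.eq_zero_or_pos p.natDegree with h0 | h0
  · exact ⟨⟨_, hp.coeff_zero_mem⟩, eq_monomial_of_natDegree_eq_zero h0⟩
  exfalso
  have hp0 : p ≠ 0 := by rintro rfl; exact absurd h0 (lt_irrefl 0)
  have hl : ∀ j, (σ ^ j) (p.coeff p.natDegree) ≠ 0 := fun j => by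
    rw [Ne, EmbeddingLike.map_eq_zero_iff]
    exact coeff_natDegree_ne_zero hp0
  rcases hp.natDegree_le.eq_or_lt with hd | hd
  · have h1 := (h 1 1 le_rfl hN).coeff_eq_zero (N + 1) (by omega)
    rw [monomial_mul_coeff 1 1 N _ p (add_comm _ _), one_mul, ← hd] at h1
    exact hl 1 h1
  -- Now the twist falls on the leading coefficient of `p`, so it is this twisted value that is
  -- divided out.
  · obtain ⟨b, hb, h1⟩ := (h (N - p.natDegree)
      (δ * e / (σ ^ (N - p.natDegree)) (p.coeff p.natDegree)) (by omega) (by omega)).coeff_top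
    rw [monomial_mul_coeff _ (N - p.natDegree) p.natDegree _ p (by omega),
      div_mul_cancel₀ _ (hl _)] at h1
    exact he (mul_left_cancel₀ hδ h1 ▸ hb)

end SkewPoly

/-! ### Galois theory of the cyclic extension -/

theorem exists_notMem_of_finrank_eq_two (hL' : Module.finrank L' L = 2) : ∃ e : L, e ∉ L' := by
  by_contra! h
  have : L' = ⊤ := by ext x; simp [h x]
  subst this
  rw [IntermediateField.finrank_top] at hL'
  omega

/-- The Galois group of a cyclic extension preserves every intermediate field. -/
theorem apply_mem_of_cyclic [FiniteDimensional K L] [IsGalois K L]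
    (hσ : ∀ τ : L ≃ₐ[K] L, τ ∈ Subgroup.zpowers σ)
    (L' : IntermediateField K L) {a : L} (ha : a ∈ L') (τ : L ≃ₐ[K] L) : τ a ∈ L' := by
  rw [← IsGalois.fixedField_fixingSubgroup L', IntermediateField.mem_fixedField_iff]
  intro g hg
  obtain ⟨i, rfl⟩ := Subgroup.mem_zpowers_iff.1 (hσ g)
  obtain ⟨j, rfl⟩ := Subgroup.mem_zpowers_iff.1 (hσ τ)
  -- The cyclic group is commutative, so `g τ a = τ g a = τ a` for every `g` fixing `L'`.
  rw [← AlgEquiv.mul_apply, (Commute.refl σ).zpow_zpow i j |>.eq, AlgEquiv.mul_apply]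
  congr 1
  exact (IntermediateField.mem_fixingSubgroup_iff _ _).1 hg a ha

theorem exists_algebraMap_eq_of_apply_eq [FiniteDimensional K L] [IsGalois K L]
    (hσ : ∀ τ : L ≃ₐ[K] L, τ ∈ Subgroup.zpowers σ) {a : L} (ha : σ a = a) :
    ∃ c : K, algebraMap K L c = a := by
  refine IntermediateField.mem_bot.1 ((IsGalois.mem_bot_iff_fixed a).2 ?_)
  intro τ
  have hle : Subgroup.zpowers σ ≤ MulAction.stabilizer (L ≃ₐ[K] L) a := by
    rw [Subgroup.zpowers_le]; exact ha
  exact hle (hσ τ)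

/-! ### The degree of `F(xⁿ)` -/

namespace SkewPoly

theorem evalXPow_eq_sum (F : Polynomial K) :
    evalXPow σ F = ∑ i ∈ Finset.range (F.natDegree + 1),
      monomial σ (Module.finrank K L * i) (algebraMap K L (F.coeff i)) := by
  rw [evalXPow, Polynomial.aeval_eq_sum_range]
  refine Finset.sum_congr rfl fun i _ => ?_
  rw [← pow_mul, X_pow, ← lmonomial_apply, ← lmonomial_apply, ← map_smul,
    Algebra.algebraMap_eq_smul_one]

variable [FiniteDimensional K L]

theorem natDegree_evalXPow {F : Polynomial K} (hF : F.Monic) :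
    (evalXPow σ F).natDegree = Module.finrank K L * F.natDegree ∧ (evalXPow σ F).Monic := by
  have hn : 0 < Module.finrank K L := Module.finrank_pos
  have htop : (evalXPow σ F).coeff (Module.finrank K L * F.natDegree) = 1 := by
    rw [evalXPow_eq_sum, ← lcoeff_apply, map_sum, Finset.sum_eq_single F.natDegree]
    · rw [lcoeff_apply, coeff_monomial, if_pos rfl, hF.coeff_natDegree, map_one]
    · intro i _ hi
      rw [lcoeff_apply, coeff_monomial, if_neg]
      exact fun h => hi (Nat.eq_of_mul_eq_mul_left hn h)
    · simp
  have hd : (evalXPow σ F).natDegree = Module.finrank K L * F.natDegree := by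
    refine le_antisymm (natDegree_le fun j hj => ?_)
      (le_natDegree (by rw [htop]; exact one_ne_zero))
    rw [evalXPow_eq_sum, ← lcoeff_apply, map_sum]
    refine Finset.sum_eq_zero fun i hi => ?_
    rw [Finset.mem_range] at hi
    rw [lcoeff_apply, coeff_monomial, if_neg]
    have := Nat.mul_le_mul_left (Module.finrank K L) (Nat.le_of_lt_succ hi)
    omega
  exact ⟨hd, by rw [Monic, hd, htop]⟩

end SkewPoly

/-! ### Idealisers, centraliser and centre of the code in `R_F` -/

section Quotient

open SkewPoly

variable [FiniteDimensional K L] [IsGalois K L] {F : Polynomial K}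

/-- Replaces the parametrisation of codewords by coefficient conditions; `N ≥ 1` keeps the slots `0`
and `N` distinct. -/
theorem mem_codeD_iff {γ : L} (hN : 1 ≤ N) {z : SkewQuotient σ F} :
    z ∈ codeD σ F L' γ N ↔ ∃ p, IsCodePoly L' γ N p ∧
      Ideal.Quotient.mk (Ideal.span {evalXPow σ F}) p = z := by
  have hcoeff : ∀ (u w : L) (a : ℕ → L) (j : ℕ),
      (monomial σ 0 u + ∑ i ∈ Finset.Ico 1 N, monomial σ i (a i) + monomial σ N w).coeff j =
        (if 0 = j then u else 0) + (if j ∈ Finset.Ico 1 N then a j else 0) +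
          if N = j then w else 0 := by
    intro u w a j
    rw [coeff_add, coeff_add, ← lcoeff_apply (∑ i ∈ _, _), map_sum]
    simp only [lcoeff_apply, coeff_monomial, Finset.sum_ite_eq']
  constructor
  · rintro ⟨u, w, a, rfl⟩
    refine ⟨_, ⟨?_, ⟨w, w.2, ?_⟩, fun i hi => ?_⟩, rfl⟩
    · rw [hcoeff, if_pos rfl, if_neg (by simp), if_neg (by omega), add_zero, add_zero]
      exact u.2
    · rw [hcoeff, if_neg (by omega), if_neg (by simp), if_pos rfl, zero_add, zero_add]
    · rw [hcoeff, if_neg (by omega), if_neg (by simp; omega), if_neg (by omega), zero_add,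
        zero_add]
  · rintro ⟨p, hp, rfl⟩
    obtain ⟨b, hb, h⟩ := hp.coeff_top
    refine ⟨⟨_, hp.coeff_zero_mem⟩, ⟨b, hb⟩, p.coeff, ?_⟩
    congr 1
    ext j
    rw [hcoeff, ← h]
    rcases lt_trichotomy j N with hj | rfl | hj
    · rcases Nat.eq_zero_or_pos j with rfl | hj0
      · rw [if_pos rfl, if_neg (by simp), if_neg (by omega), add_zero, add_zero]
      · rw [if_neg (by omega), if_pos (by simp; omega), if_neg (by omega), zero_add, add_zero]
    · rw [if_neg (by omega), if_neg (by simp), if_pos rfl, zero_add, zero_add]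
    · rw [if_neg (by omega), if_neg (by simp; omega), if_neg (by omega), hp.coeff_eq_zero j hj,
        zero_add, zero_add]

theorem eq_of_mk_eq_mk (hF : F.Monic) {p q : SkewPoly σ}
    (h : Ideal.Quotient.mk (Ideal.span {evalXPow σ F}) p = Ideal.Quotient.mk _ q)
    (hp : ∀ i, Module.finrank K L * F.natDegree ≤ i → p.coeff i = 0)
    (hq : ∀ i, Module.finrank K L * F.natDegree ≤ i → q.coeff i = 0) : p = q := by
  rw [Ideal.Quotient.mk_eq_mk_iff_sub_mem] at h
  refine sub_eq_zero.1 (eq_zero_of_mem_span_of_lt h fun i hi => ?_)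
  rw [(natDegree_evalXPow hF).1] at hi
  rw [coeff_sub, hp i hi, hq i hi, sub_zero]

variable (σ F) in
/-- The constants, as a homomorphism `L → R_F`. -/
def constHom : L →ₐ[K] SkewQuotient σ F where
  toFun a := Ideal.Quotient.mk _ (monomial σ 0 a)
  map_one' := by rw [← one_def, map_one]
  map_mul' a b := by
    rw [← map_mul, monomial_mul_monomial, pow_zero]; rfl
  map_zero' := by rw [← lmonomial_apply, map_zero, map_zero]
  map_add' a b := by
    rw [← map_add, ← lmonomial_apply, ← lmonomial_apply, ← lmonomial_apply, map_add]
  commutes' c := by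
    rw [← algebraMap_eq_monomial]; rfl

/-- Since `1` is a codeword, the idealiser lies inside the code, so each of its elements has a code
polynomial `p` as representative. Multiplying by the codewords `c x ^ j` then leaves only constants.
-/
theorem mem_leftIdealiser_codeD (hF : F.Monic) (hN : 2 ≤ N)
    (hNn : 2 * N ≤ Module.finrank K L * F.natDegree) {e : L} (he : e ∉ L') (hδ : δ ≠ 0)
    {z : SkewQuotient σ F} :
    z ∈ leftIdealiser (codeD σ F L' δ N) ↔ ∃ a : L', constHom σ F a = z := by
  constructor
  · intro hz
    have h1 : z * 1 ∈ codeD σ F L' δ N :=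
      hz 1 ((mem_codeD_iff (by omega)).2
        ⟨_, isCodePoly_monomial_zero (by omega) 1, map_one (constHom σ F)⟩)
    rw [mul_one, mem_codeD_iff (by omega)] at h1
    obtain ⟨p, hp, rfl⟩ := h1
    obtain ⟨a, rfl⟩ := hp.eq_monomial_zero_of_mul hN hδ he fun j c hj hjN => by
      obtain ⟨q, hq, hqp⟩ := (mem_codeD_iff (by omega)).1
        (hz _ ((mem_codeD_iff (by omega)).2 ⟨_, isCodePoly_monomial hj hjN c, rfl⟩))
      rw [← map_mul] at hqp
      -- Both sides have degree below `2N ≤ deg F(xⁿ)`, so congruence is equality and the product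
      -- itself is a code polynomial.
      rwa [← eq_of_mk_eq_mk hF hqp (fun i hi => hq.coeff_eq_zero i (by omega))
        (fun i hi => hp.mul_monomial_coeff_eq_zero hjN (by omega))]
    exact ⟨a, rfl⟩
  · rintro ⟨a, rfl⟩ y hy
    obtain ⟨p, hp, rfl⟩ := (mem_codeD_iff (by omega)).1 hy
    exact (mem_codeD_iff (by omega)).2 ⟨_, hp.monomial_zero_mul a, map_mul _ _ _⟩

theorem mem_rightIdealiser_codeD (hσ : ∀ τ : L ≃ₐ[K] L, τ ∈ Subgroup.zpowers σ)
    (hF : F.Monic) (hN : 2 ≤ N)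
    (hNn : 2 * N ≤ Module.finrank K L * F.natDegree) {e : L} (he : e ∉ L') (hδ : δ ≠ 0)
    {z : SkewQuotient σ F} :
    z ∈ rightIdealiser (codeD σ F L' δ N) ↔ ∃ a : L', constHom σ F a = z := by
  constructor
  · intro hz
    have h1 : 1 * z ∈ codeD σ F L' δ N :=
      hz 1 ((mem_codeD_iff (by omega)).2
        ⟨_, isCodePoly_monomial_zero (by omega) 1, map_one (constHom σ F)⟩)
    rw [one_mul, mem_codeD_iff (by omega)] at h1
    obtain ⟨p, hp, rfl⟩ := h1
    obtain ⟨a, rfl⟩ := hp.eq_monomial_zero_of_monomial_mul hN hδ he fun j c hj hjN => by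
      obtain ⟨q, hq, hqp⟩ := (mem_codeD_iff (by omega)).1
        (hz _ ((mem_codeD_iff (by omega)).2 ⟨_, isCodePoly_monomial hj hjN c, rfl⟩))
      rw [← map_mul] at hqp
      rwa [← eq_of_mk_eq_mk hF hqp (fun i hi => hq.coeff_eq_zero i (by omega))
        (fun i hi => hp.monomial_mul_coeff_eq_zero hjN (by omega))]
    exact ⟨a, rfl⟩
  · rintro ⟨a, rfl⟩ y hy
    obtain ⟨p, hp, rfl⟩ := (mem_codeD_iff (by omega)).1 hy
    -- A constant on the right is twisted by powers of `σ`, which preserve `L'`.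
    exact (mem_codeD_iff (by omega)).2
      ⟨_, hp.mul_monomial_zero a fun i => apply_mem_of_cyclic hσ L' a.2 _, map_mul _ _ _⟩

/-- `x` is invertible modulo `F(xⁿ)` if `F(0) ≠ 0`. -/
theorem isUnit_mk_X (hF : F.coeff 0 ≠ 0) :
    IsUnit (Ideal.Quotient.mk (Ideal.span {evalXPow σ F}) (X σ)) := by
  obtain ⟨n, hn⟩ := Nat.exists_eq_succ_of_ne_zero (Module.finrank_pos (R := K) (M := L)).ne'
  have h0 : Polynomial.aeval (Ideal.Quotient.mk (Ideal.span {evalXPow σ F}) (X σ) ^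
      Module.finrank K L) F = 0 := by
    have h1 := Polynomial.aeval_algHom_apply (Ideal.Quotient.mkₐ K (Ideal.span {evalXPow σ F}))
      (X σ ^ Module.finrank K L) F
    rw [map_pow] at h1
    refine h1.trans ?_
    exact Ideal.Quotient.eq_zero_iff_mem.2 (Ideal.mem_span_singleton_self _)
  set x := Ideal.Quotient.mk (Ideal.span {evalXPow σ F}) (X σ) with hx
  have h2 := congrArg (Polynomial.aeval (x ^ Module.finrank K L)) (Polynomial.X_mul_divX_add F)
  rw [map_add, map_mul, Polynomial.aeval_X, Polynomial.aeval_C, h0] at h2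
  set y := Polynomial.aeval (x ^ Module.finrank K L) F.divX
  have hc : Commute x y := Algebra.commute_of_mem_adjoin_singleton_of_commute
    (Polynomial.aeval_mem_adjoin_singleton K (x ^ Module.finrank K L))
    ((Commute.refl x).pow_right _)
  -- From `F = X * F.divX + F(0)` evaluated at `x ^ [L : K]`, `x ^ [L : K] * y = -F(0)`. Here `n + 1
  -- = [L : K]`, so one factor `x` splits off.
  have h3 : x * (x ^ n * y * algebraMap K _ (-(F.coeff 0)⁻¹)) = 1 := by
    rw [← mul_assoc, ← mul_assoc, ← pow_succ', ← Nat.succ_eq_add_one, ← hn,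
      eq_neg_of_add_eq_zero_left h2, ← map_neg, ← map_mul, neg_mul_neg, mul_inv_cancel₀ hF, map_one]
  refine ⟨⟨x, _, h3, ?_⟩, rfl⟩
  rw [← h3]
  exact ((((Commute.refl x).pow_right n).mul_right hc).mul_right
    (Algebra.commutes _ x).symm).symm

/-- As `N ≥ 2`, all `c x` are codewords. An element commuting with `x` and with `c x` commutes with
`c`, because the unit `x` cancels; constants and `x` generate `R_F`. -/
theorem codeCentraliser_codeD (hF : F.coeff 0 ≠ 0) (hN : 2 ≤ N) :
    codeCentraliser (codeD σ F L' δ N) = centreEF σ F := by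
  refine le_antisymm (fun z hz => ?_) (Subalgebra.center_le_centralizer K _)
  have hmon : ∀ c, Ideal.Quotient.mk (Ideal.span {evalXPow σ F}) (monomial σ 1 c) * z =
      z * Ideal.Quotient.mk (Ideal.span {evalXPow σ F}) (monomial σ 1 c) := fun c =>
    Subalgebra.mem_centralizer_iff K |>.1 hz _
      ((mem_codeD_iff (by omega)).2 ⟨_, isCodePoly_monomial le_rfl hN c, rfl⟩)
  rw [Subalgebra.mem_center_iff]
  intro y
  obtain ⟨p, rfl⟩ := Ideal.Quotient.mk_surjective y
  refine induction_mul (P := fun p => Ideal.Quotient.mk (Ideal.span {evalXPow σ F}) p * z =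
    z * Ideal.Quotient.mk (Ideal.span {evalXPow σ F}) p) ?_ ?_ (fun a => ?_) (hmon 1) p
  · intro p q hp hq
    rw [map_add, add_mul, hp, hq, mul_add]
  · intro p q hp hq
    rw [map_mul, mul_assoc, hq, ← mul_assoc, hp, mul_assoc]
  · have h := hmon a
    rw [monomial_eq_mul_X_pow, pow_one, map_mul, mul_assoc,
      show Ideal.Quotient.mk _ (X σ) * z = z * _ from hmon 1,
      ← mul_assoc, ← mul_assoc] at h
    exact (isUnit_mk_X hF).mul_left_injective h

theorem mem_codeCentre_codeD (hσ : ∀ τ : L ≃ₐ[K] L, τ ∈ Subgroup.zpowers σ)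
    (hF : F.Monic) (hF0 : F.coeff 0 ≠ 0) (hN : 2 ≤ N)
    (hNn : 2 * N ≤ Module.finrank K L * F.natDegree) {e : L} (he : e ∉ L') (hδ : δ ≠ 0)
    {z : SkewQuotient σ F} :
    z ∈ codeCentre (codeD σ F L' δ N) ↔ z ∈ (⊥ : Subalgebra K (SkewQuotient σ F)) := by
  refine ⟨fun hz => ?_, fun hz => bot_le (a := codeCentre (codeD σ F L' δ N)) hz⟩
  obtain ⟨a, rfl⟩ := (mem_leftIdealiser_codeD hF hN hNn he hδ).1 hz.1
  have h1 := hz.2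
  rw [SetLike.mem_coe, codeCentraliser_codeD hF0 hN, Subalgebra.mem_center_iff] at h1
  have h2 : Ideal.Quotient.mk (Ideal.span {evalXPow σ F}) (X σ * monomial σ 0 (a : L)) =
      Ideal.Quotient.mk _ (monomial σ 0 (a : L) * X σ) := h1 (Ideal.Quotient.mk _ (X σ))
  rw [X, monomial_mul_monomial, monomial_mul_monomial] at h2
  -- Comparing the coefficients of `x` in `x a` and `a x` gives `σ a = a`.
  have h3 := congrArg (fun p => p.coeff 1) (eq_of_mk_eq_mk hF h2
    (fun i hi => by rw [coeff_monomial, if_neg (by omega)])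
    (fun i hi => by rw [coeff_monomial, if_neg (by omega)]))
  simp only [coeff_monomial, add_zero, zero_add, if_pos, one_mul, pow_one, map_one, mul_one] at h3
  obtain ⟨c, hc⟩ := exists_algebraMap_eq_of_apply_eq hσ h3
  rw [← hc, AlgHom.commutes]
  exact Subalgebra.algebraMap_mem _ c

theorem constHom_injective (hF : F.Monic) (hF1 : 1 ≤ Module.finrank K L * F.natDegree) :
    Function.Injective (constHom σ F) := by
  rw [injective_iff_map_eq_zero]
  intro a ha
  have h := eq_of_mk_eq_mk hF (p := monomial σ 0 a) (q := 0) (ha.trans (map_zero _).symm)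
    (fun i hi => by rw [coeff_monomial, if_neg (by omega)]) (fun i hi => rfl)
  have := congrArg (fun p => p.coeff 0) h
  simpa only [coeff_monomial, if_pos, coeff_zero] using this

end Quotient

/-! ### Transport of the code invariants along an algebra isomorphism -/

section Transport

variable {T T' B : Type*} [Ring T] [Algebra K T] [Ring T'] [Algebra K T'] [Ring B] [Algebra K B]

/-- A subalgebra that is the range of an injective homomorphism is isomorphic to the source. -/
theorem nonempty_algEquiv_of_mem_iff {S : Subalgebra K T} (j : B →ₐ[K] T)
    (hj : Function.Injective j) (h : ∀ z, z ∈ S ↔ ∃ b, j b = z) : Nonempty (S ≃ₐ[K] B) := by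
  have : S = j.range := by ext z; rw [h]; rfl
  subst this
  exact ⟨(AlgEquiv.ofInjective j hj).symm⟩

theorem nonempty_algEquiv_of_mem_map_iff (Φ : T ≃ₐ[K] T') {S : Subalgebra K T}
    {S' : Subalgebra K T'} (h : ∀ z, Φ z ∈ S' ↔ z ∈ S) : Nonempty (S' ≃ₐ[K] S) :=
  nonempty_algEquiv_of_mem_iff (Φ.toAlgHom.comp S.val)
    (Φ.injective.comp Subtype.val_injective) fun z => by
      obtain ⟨w, rfl⟩ := Φ.surjective z
      rw [h]
      constructor
      · intro hw; exact ⟨⟨w, hw⟩, rfl⟩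
      · rintro ⟨b, hb⟩
        rw [← Φ.injective hb]; exact b.2

variable (Φ : T ≃ₐ[K] T') (C : Submodule K T)

theorem apply_mem_map_iff {z : T} : Φ z ∈ C.map Φ.toLinearMap ↔ z ∈ C := by
  constructor
  · rintro ⟨w, hw, h⟩
    rwa [← Φ.injective h]
  · exact fun h => ⟨z, h, rfl⟩

theorem apply_mem_leftIdealiser_map_iff {z : T} :
    Φ z ∈ leftIdealiser (C.map Φ.toLinearMap) ↔ z ∈ leftIdealiser C := by
  constructor
  · intro h y hy
    rw [← apply_mem_map_iff Φ, map_mul]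
    exact h _ ((apply_mem_map_iff Φ C).2 hy)
  · rintro h _ ⟨y, hy, rfl⟩
    change Φ z * Φ y ∈ _
    rw [← map_mul, apply_mem_map_iff]
    exact h y hy

theorem apply_mem_rightIdealiser_map_iff {z : T} :
    Φ z ∈ rightIdealiser (C.map Φ.toLinearMap) ↔ z ∈ rightIdealiser C := by
  constructor
  · intro h y hy
    rw [← apply_mem_map_iff Φ, map_mul]
    exact h _ ((apply_mem_map_iff Φ C).2 hy)
  · rintro h _ ⟨y, hy, rfl⟩
    change Φ y * Φ z ∈ _
    rw [← map_mul, apply_mem_map_iff]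
    exact h y hy

theorem apply_mem_codeCentraliser_map_iff {z : T} :
    Φ z ∈ codeCentraliser (C.map Φ.toLinearMap) ↔ z ∈ codeCentraliser C := by
  rw [codeCentraliser, codeCentraliser, Subalgebra.mem_centralizer_iff,
    Subalgebra.mem_centralizer_iff]
  constructor
  · intro h y hy
    apply Φ.injective
    rw [map_mul, map_mul]
    exact h _ ((apply_mem_map_iff Φ C).2 hy)
  · rintro h _ ⟨y, hy, rfl⟩
    change Φ y * Φ z = Φ z * Φ y
    rw [← map_mul, ← map_mul, h y hy]

theorem apply_mem_codeCentre_map_iff {z : T} :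
    Φ z ∈ codeCentre (C.map Φ.toLinearMap) ↔ z ∈ codeCentre C :=
  and_congr (apply_mem_leftIdealiser_map_iff Φ C) (apply_mem_codeCentraliser_map_iff Φ C)

end Transport

/-- The invariants of the code `D_{n,sℓ,k}(γ, F)`. -/
theorem invariants_codeD [FiniteDimensional K L] [IsGalois K L]
    (hσ : ∀ τ : L ≃ₐ[K] L, τ ∈ Subgroup.zpowers σ) (hL' : Module.finrank L' L = 2)
    {F : Polynomial K} (hF : F.Monic) (hF0 : F.coeff 0 ≠ 0) (hδ : δ ≠ 0) (hN : 2 ≤ N)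
    (hNn : 2 * N ≤ Module.finrank K L * F.natDegree) :
    Nonempty (leftIdealiser (codeD σ F L' δ N) ≃ₐ[K] L') ∧
    Nonempty (rightIdealiser (codeD σ F L' δ N) ≃ₐ[K] L') ∧
    Nonempty (codeCentraliser (codeD σ F L' δ N) ≃ₐ[K] centreEF σ F) ∧
    Nonempty (codeCentre (codeD σ F L' δ N) ≃ₐ[K] K) := by
  obtain ⟨e, he⟩ := exists_notMem_of_finrank_eq_two hL'
  have hinj := constHom_injective (σ := σ) hF (by omega)
  have hinj' : Function.Injective ((constHom σ F).comp L'.val) :=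
    hinj.comp Subtype.val_injective
  refine ⟨nonempty_algEquiv_of_mem_iff ((constHom σ F).comp L'.val) hinj'
      fun z => mem_leftIdealiser_codeD hF hN hNn he hδ,
    nonempty_algEquiv_of_mem_iff ((constHom σ F).comp L'.val) hinj'
      fun z => mem_rightIdealiser_codeD hσ hF hN hNn he hδ, ?_,
    nonempty_algEquiv_of_mem_iff (Algebra.ofId K (SkewQuotient σ F)) ?_ fun z => ?_⟩
  · rw [codeCentraliser_codeD hF0 hN]
    exact ⟨AlgEquiv.refl⟩
  · rw [Subsingleton.elim (Algebra.ofId K (SkewQuotient σ F))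
      ((constHom σ F).comp (Algebra.ofId K L))]
    exact hinj.comp (algebraMap K L).injective
  · rw [mem_codeCentre_codeD hσ hF hF0 hN hNn he hδ]
    exact Algebra.mem_bot

end

/-! ### Nuclei and centre of `(R / Rf, ⋆_D)` -/

noncomputable section
variable {K L : Type*} [Field K] [Field L] [Algebra K L] {σ : L ≃ₐ[K] L}

theorem nonassocAlgIso_of_mem_iff {A B : Type*} [NonUnitalNonAssocRing A] [Module K A]
    [IsScalarTower K A A] [SMulCommClass K A A] [NonUnitalNonAssocRing B] [Module K B]
    {S : NonUnitalSubalgebra K A} (j : B →ₗ[K] A) (hj : Function.Injective j)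
    (hmul : ∀ x y, j (x * y) = j x * j y) (h : ∀ z, z ∈ S ↔ ∃ b, j b = z) :
    NonassocAlgIso K S B := by
  let e : B ≃ₗ[K] S := LinearEquiv.ofBijective
    (LinearMap.codRestrict S.toSubmodule j fun b => (h _).2 ⟨b, rfl⟩)
    ⟨fun x y hxy => hj (congrArg Subtype.val hxy), fun z => by
      obtain ⟨b, hb⟩ := (h z).1 z.2
      exact ⟨b, Subtype.ext hb⟩⟩
  have he : ∀ x y, e (x * y) = e x * e y := fun x y => Subtype.ext (hmul x y)
  refine ⟨e.symm, fun x y => ?_⟩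
  rw [LinearEquiv.symm_apply_eq, he, e.apply_symm_apply, e.apply_symm_apply]

namespace HKAlgebra

open SkewPoly

variable {L' : IntermediateField K L}
  {hL' : Module.finrank L' L = 2} {γ : L} {hN : ¬ IsSquare (Algebra.norm K γ)}
  {f : SkewPoly σ} {hf : f.Monic}

local notation "π" => mk L' hL' γ hN f hf

theorem mk_eq_mk {p q : SkewPoly σ} : π p = π q ↔ p - q ∈ Ideal.span {f} :=
  Submodule.Quotient.eq _

theorem mk_eq_zero {p : SkewPoly σ} : π p = 0 ↔ p ∈ Ideal.span {f} :=
  Submodule.Quotient.mk_eq_zero _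

theorem mk_surjective (z : HKAlgebra L' hL' γ hN f hf) : ∃ p, π p = z :=
  Submodule.Quotient.mk_surjective _ z

theorem mk_mul_congr (r : SkewPoly σ) {p q : SkewPoly σ}
    (h : π p = π q) : π (r * p) = π (r * q) := by
  rw [mk_eq_mk] at h ⊢
  rw [← mul_sub]
  exact Ideal.mul_mem_left _ _ h

/-- Writing `f = g x + f₀` gives `1 ≡ -f₀⁻¹ g x` modulo `Rf`; multiplying by `p` and moving `x` to
the left shows that `x` acts surjectively on `R / Rf`. -/
theorem exists_X_mul (h0 : f.coeff 0 ≠ 0)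
    (p : SkewPoly σ) : ∃ q, π p = π (X σ * q) := by
  obtain ⟨g, hg⟩ := exists_eq_mul_X_add f
  obtain ⟨q, hq⟩ := exists_mul_X_eq_X_mul (p * (-(monomial σ 0 (f.coeff 0)⁻¹ * g)))
  refine ⟨q, ?_⟩
  rw [← hq, mk_eq_mk]
  refine Ideal.mem_span_singleton'.2 ⟨p * monomial σ 0 (f.coeff 0)⁻¹, ?_⟩
  have h1 : monomial σ 0 (f.coeff 0)⁻¹ * monomial σ 0 (f.coeff 0) = 1 := by
    rw [monomial_mul_monomial, pow_zero, AlgEquiv.one_apply, inv_mul_cancel₀ h0, one_def]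
  have h2 := congrArg (p * monomial σ 0 (f.coeff 0)⁻¹ * ·) hg
  simp only [mul_add] at h2
  rw [h2, mul_assoc p _ (monomial σ 0 _), h1]
  noncomm_ring

variable [FiniteDimensional K L]

variable (L' hL' γ hN f hf) in
/-- The class map as a `K`-linear map. -/
def lmk : SkewPoly σ →ₗ[K] HKAlgebra L' hL' γ hN f hf :=
  (Ideal.span {f}).mkQ.restrictScalars K

theorem lmk_apply (p : SkewPoly σ) : lmk L' hL' γ hN f hf p = π p := rfl

/-- If `δ b` is the top coefficient of `p`, with `δ = γ / f₀`, the reduced representative is `p - δ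
b f`. Its constant term is `p₀ - γ b`, so `a₀'' = -b`, and the correction in the lift restores `p`.
-/
theorem hughesLift_mk (h0 : f.coeff 0 ≠ 0) {p : SkewPoly σ}
    (hp : IsCodePoly L' (γ / f.coeff 0) f.natDegree p) :
    hughesLift L' hL' γ hN f hf (Submodule.Quotient.mk p) = p := by
  obtain ⟨b, hb, h⟩ := hp.coeff_top
  have hfd : f.coeff f.natDegree = 1 := hf
  set q := p - monomial σ 0 (γ / f.coeff 0 * b) * f with hq
  have hqd : q ∈ degreeLT σ f.natDegree := by
    intro j hj
    rw [hq, coeff_sub, monomial_zero_mul_coeff]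
    rcases hj.eq_or_lt with rfl | hj
    · rw [h, hfd, mul_one, sub_self]
    · rw [hp.coeff_eq_zero j hj, coeff_eq_zero_of_natDegree_lt f hj, mul_zero, sub_zero]
  have hqe : f.quotientEquiv hf (Submodule.Quotient.mk p) = ⟨q, hqd⟩ := by
    rw [SkewPoly.quotientEquiv, LinearEquiv.symm_apply_eq]
    refine (Submodule.Quotient.eq _).2 (Ideal.mem_span_singleton'.2
      ⟨monomial σ 0 (γ / f.coeff 0 * b), ?_⟩)
    change _ = p - q
    rw [hq]; abel
  have hq0 : q.coeff 0 = splitEquiv L' hL' γ (notMem_of_norm_not_square L' hL' hN)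
      (⟨p.coeff 0, hp.coeff_zero_mem⟩, ⟨-b, neg_mem hb⟩) := by
    rw [splitEquiv_apply, hq, coeff_sub, monomial_zero_mul_coeff]
    field_simp
    ring
  change (f.quotientEquiv hf (Submodule.Quotient.mk p) : SkewPoly σ) -
    monomial σ 0 (γ / f.coeff 0 *
      ((splitEquiv L' hL' γ (notMem_of_norm_not_square L' hL' hN)).symm
        ((f.quotientEquiv hf (Submodule.Quotient.mk p) : SkewPoly σ).coeff 0)).2) * f = p
  rw [hqe]
  simp only [hq0, LinearEquiv.symm_apply_apply]
  rw [mul_neg, hq, ← lmonomial_apply, ← lmonomial_apply, map_neg]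
  noncomm_ring

theorem exists_isCodePoly (h0 : f.coeff 0 ≠ 0)
    (z : HKAlgebra L' hL' γ hN f hf) :
    ∃ p, IsCodePoly L' (γ / f.coeff 0) f.natDegree p ∧ π p = z := by
  obtain ⟨a, rfl⟩ := mk_surjective z
  obtain ⟨g, p, rfl, hp⟩ := exists_mul_add_of_monic hf a
  set e := splitEquiv L' hL' γ (notMem_of_norm_not_square L' hL' hN) with he
  obtain ⟨⟨u, w⟩, huw⟩ := e.surjective (p.coeff 0)
  rw [he, splitEquiv_apply] at huw
  -- With `p₀ = u + γ w`, this has constant coefficient `u` and top coefficient `-(γ / f₀) w`.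
  refine ⟨p - monomial σ 0 (γ / f.coeff 0 * w) * f, ⟨?_, ⟨-w, neg_mem w.2, ?_⟩, fun i hi => ?_⟩, ?_⟩
  · rw [coeff_sub, monomial_zero_mul_coeff, ← huw]
    convert u.2 using 1
    field_simp
    ring
  · rw [coeff_sub, monomial_zero_mul_coeff, show f.coeff f.natDegree = 1 from hf, hp _ le_rfl]
    ring
  · rw [coeff_sub, monomial_zero_mul_coeff, hp i hi.le, coeff_eq_zero_of_natDegree_lt f hi,
      mul_zero, sub_zero]
  · rw [mk_eq_mk]
    refine Ideal.mem_span_singleton'.2 ⟨-(monomial σ 0 (γ / f.coeff 0 * w)) - g, ?_⟩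
    noncomm_ring

theorem mk_mul (h0 : f.coeff 0 ≠ 0)
    {p : SkewPoly σ} (hp : IsCodePoly L' (γ / f.coeff 0) f.natDegree p)
    (q : SkewPoly σ) : π p * π q = π (p * q) :=
  congrArg (· • (Submodule.Quotient.mk q : SkewPoly σ ⧸ Ideal.span {f}))
    (hughesLift_mk (hL' := hL') (hN := hN) (hf := hf) h0 hp)

theorem mk_const_mul (hd : 2 ≤ f.natDegree) (h0 : f.coeff 0 ≠ 0)
    (a : L') (q : SkewPoly σ) :
    π (monomial σ 0 (a : L)) * π q = π (monomial σ 0 (a : L) * q) :=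
  mk_mul h0 (isCodePoly_monomial_zero (by omega) a) q

theorem mul_mk_one (h0 : f.coeff 0 ≠ 0)
    (z : HKAlgebra L' hL' γ hN f hf) : z * π 1 = z := by
  obtain ⟨p, hp, rfl⟩ := exists_isCodePoly h0 z
  rw [mk_mul h0 hp, mul_one]

theorem mk_one_mul (hd : 2 ≤ f.natDegree) (h0 : f.coeff 0 ≠ 0)
    (z : HKAlgebra L' hL' γ hN f hf) : π 1 * z = z := by
  obtain ⟨p, rfl⟩ := mk_surjective z
  have := mk_const_mul (hL' := hL') (hN := hN) (hf := hf) hd h0 1 p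
  rwa [OneMemClass.coe_one, ← one_def, one_mul] at this

/-- Faithfulness of the action on `R / Rf` in degrees below `2 deg f`; it plays the part that
uniqueness of remainders modulo `F(xⁿ)` plays for the code. -/
theorem eq_of_forall_mk_mul_eq (hd : 2 ≤ f.natDegree)
    (hfi : Irreducible f) (hfc : f ∉ Subalgebra.center K (SkewPoly σ))
    {p q : SkewPoly σ} (h : ∀ r, π (p * r) = π (q * r))
    (hp : ∀ i, 2 * f.natDegree ≤ i → p.coeff i = 0)
    (hq : ∀ i, 2 * f.natDegree ≤ i → q.coeff i = 0) : p = q := by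
  refine sub_eq_zero.1 (eq_zero_of_annihilates hf hfi hd hfc (fun r => ?_) fun i hi => ?_)
  · rw [sub_mul]
    exact mk_eq_mk.1 (h r)
  · rw [coeff_sub, hp i hi, hq i hi, sub_zero]

/-- The left idealiser argument again, for the operators by which code polynomials act:
associativity says that `p c x ^ j` acts as the code representative of the product does, and
faithfulness makes the two equal. -/
theorem mem_leftNucleus_iff (hd : 2 ≤ f.natDegree) (h0 : f.coeff 0 ≠ 0)
    (hfi : Irreducible f) (hfc : f ∉ Subalgebra.center K (SkewPoly σ))
    (z : HKAlgebra L' hL' γ hN f hf) :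
    z ∈ leftNucleus K (HKAlgebra L' hL' γ hN f hf) ↔
      ∃ a : L', π (monomial σ 0 (a : L)) = z := by
  obtain ⟨e, he⟩ := exists_notMem_of_finrank_eq_two hL'
  have hδ : γ / f.coeff 0 ≠ 0 := div_ne_zero
    (fun h => notMem_of_norm_not_square L' hL' hN (h ▸ zero_mem _)) h0
  constructor
  · intro hz
    obtain ⟨p, hp, rfl⟩ := exists_isCodePoly h0 z
    obtain ⟨a, rfl⟩ := hp.eq_monomial_zero_of_mul hd hδ he fun j c hj hjN => by
      have hc := isCodePoly_monomial (σ := σ) (L' := L') (δ := γ / f.coeff 0) hj hjN c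
      obtain ⟨q, hq, hqp⟩ := exists_isCodePoly h0 (π p * π (monomial σ j c))
      rwa [← eq_of_forall_mk_mul_eq (hL' := hL') (hN := hN) (hf := hf) hd hfi hfc (p := q)
        (fun r => ?_) (fun i hi => hq.coeff_eq_zero i (by omega))
        (fun i hi => hp.mul_monomial_coeff_eq_zero hjN hi)]
      have h1 := hz (π (monomial σ j c)) (π r)
      rw [← hqp, mk_mul h0 hq, mk_mul h0 hc, mk_mul h0 hp] at h1
      rw [← h1, mul_assoc]
    exact ⟨a, rfl⟩
  · rintro ⟨a, rfl⟩ b c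
    obtain ⟨p, hp, rfl⟩ := exists_isCodePoly h0 b
    obtain ⟨q, rfl⟩ := mk_surjective c
    rw [mk_mul h0 hp, mk_const_mul hd h0, mk_const_mul hd h0,
      mk_mul h0 (hp.monomial_zero_mul a), mul_assoc]

/-- The right idealiser counterpart: the products are now `c x ^ j p`, and the converse uses that
`σ` preserves `L'`. -/
theorem mem_middleNucleus_iff (hd : 2 ≤ f.natDegree) (h0 : f.coeff 0 ≠ 0)
    (hfi : Irreducible f) (hfc : f ∉ Subalgebra.center K (SkewPoly σ))
    [IsGalois K L] (hσ : ∀ τ : L ≃ₐ[K] L, τ ∈ Subgroup.zpowers σ)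
    (z : HKAlgebra L' hL' γ hN f hf) :
    z ∈ middleNucleus K (HKAlgebra L' hL' γ hN f hf) ↔
      ∃ a : L', π (monomial σ 0 (a : L)) = z := by
  obtain ⟨e, he⟩ := exists_notMem_of_finrank_eq_two hL'
  have hδ : γ / f.coeff 0 ≠ 0 := div_ne_zero
    (fun h => notMem_of_norm_not_square L' hL' hN (h ▸ zero_mem _)) h0
  constructor
  · intro hz
    obtain ⟨p, hp, rfl⟩ := exists_isCodePoly h0 z
    obtain ⟨a, rfl⟩ := hp.eq_monomial_zero_of_monomial_mul hd hδ he fun j c hj hjN => by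
      have hc := isCodePoly_monomial (σ := σ) (L' := L') (δ := γ / f.coeff 0) hj hjN c
      obtain ⟨q, hq, hqp⟩ := exists_isCodePoly h0 (π (monomial σ j c) * π p)
      rwa [← eq_of_forall_mk_mul_eq (hL' := hL') (hN := hN) (hf := hf) hd hfi hfc (p := q)
        (fun r => ?_) (fun i hi => hq.coeff_eq_zero i (by omega))
        (fun i hi => hp.monomial_mul_coeff_eq_zero hjN hi)]
      have h1 := hz (π (monomial σ j c)) (π r)
      rw [← hqp, mk_mul h0 hq, mk_mul h0 hp, mk_mul h0 hc] at h1
      rw [← h1, mul_assoc]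
    exact ⟨a, rfl⟩
  · rintro ⟨a, rfl⟩ b c
    obtain ⟨p, hp, rfl⟩ := exists_isCodePoly h0 b
    obtain ⟨q, rfl⟩ := mk_surjective c
    rw [mk_const_mul hd h0, mk_mul h0 hp, mk_mul h0 hp, mk_mul h0
      (hp.mul_monomial_zero a fun i => apply_mem_of_cyclic hσ L' a.2 _), mul_assoc]

/-- Multiplying on the right by an element that `f` annihilates is well defined. -/
theorem mk_mul_of_mul_mem (h0 : f.coeff 0 ≠ 0)
    {p q : SkewPoly σ} (hq : f * q ∈ Ideal.span {f}) :
    π p * π q = π (p * q) := by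
  obtain ⟨p', hp', h⟩ := exists_isCodePoly h0 (π p)
  rw [← h, mk_mul h0 hp', mk_eq_mk, ← sub_mul]
  obtain ⟨g, hg⟩ := Ideal.mem_span_singleton'.1 (mk_eq_mk.1 h)
  rw [← hg, mul_assoc]
  exact Ideal.mul_mem_left _ _ hq

/-- Right multiplication by an element of the right nucleus commutes with the action of all code
polynomials, hence of all of `R`. It is then an endomorphism of `R / Rf`, and `f` must kill the
image of `1`. -/
theorem mk_mem_rightNucleus_iff (hd : 2 ≤ f.natDegree) (h0 : f.coeff 0 ≠ 0)
    (p : SkewPoly σ) :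
    π p ∈ rightNucleus K (HKAlgebra L' hL' γ hN f hf) ↔ f * p ∈ Ideal.span {f} := by
  constructor
  · intro hp
    have hstep : ∀ q, IsCodePoly L' (γ / f.coeff 0) f.natDegree q → ∀ u v,
        π v = π u * π p → π (q * u) * π p = π (q * v) := by
      intro q hq u v huv
      have h1 := hp (π q) (π u)
      rw [← huv, mk_mul h0 hq, mk_mul h0 hq] at h1
      exact h1.symm
    -- Linearity over `R`, with `v` a representative of the class of `u` times `p`.
    have key : ∀ r u v, π v = π u * π p → π (r * u) * π p = π (r * v) := by
      intro r
      refine induction_mul (P := fun r => ∀ u v, π v = π u * π p →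
        π (r * u) * π p = π (r * v)) ?_ ?_ (fun a u v huv => ?_) ?_ r
      · intro r s hr hs u v huv
        rw [add_mul, add_mul, ← lmk_apply (r * u + s * u), map_add, add_mul, lmk_apply, lmk_apply,
          hr u v huv, hs u v huv, ← lmk_apply (r * v + s * v), map_add]
        rfl
      · intro r s hr hs u v huv
        rw [mul_assoc, mul_assoc]
        exact hr _ _ (hs u v huv).symm
      -- An arbitrary constant `a` need not be a code polynomial, but `x` and `a x` are, since `deg
      -- f ≥ 2`. Writing `u ≡ x u'` turns `a u` into `(a x) u'`.
      · obtain ⟨u', hu'⟩ := exists_X_mul (hL' := hL') (γ := γ) (hN := hN) (hf := hf) h0 u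
        obtain ⟨v', hv'⟩ := mk_surjective (π u' * π p)
        have hX := hstep (X σ) (isCodePoly_monomial le_rfl hd 1) u' v' hv'
        have haX := hstep (monomial σ 1 a) (isCodePoly_monomial le_rfl hd a) u' v' hv'
        rw [monomial_eq_mul_X_pow, pow_one, mul_assoc, mul_assoc] at haX
        rw [mk_mul_congr _ hu', haX]
        exact mk_mul_congr _ (by rw [huv, hu', hX])
      · exact hstep (X σ) (isCodePoly_monomial le_rfl hd 1)
    have h1 := key f 1 p (by rw [mk_one_mul hd h0])
    rw [mul_one, mk_eq_zero.2 (Ideal.mem_span_singleton_self f), zero_mul] at h1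
    exact mk_eq_zero.1 h1.symm
  · intro hp a b
    obtain ⟨q, hq, rfl⟩ := exists_isCodePoly h0 a
    obtain ⟨r, rfl⟩ := mk_surjective b
    rw [mk_mul_of_mul_mem h0 hp, mk_mul h0 hq, mk_mul h0 hq,
      mk_mul_of_mul_mem h0 hp, mul_assoc]

theorem mem_algebraCentre_iff (hd : 2 ≤ f.natDegree) (h0 : f.coeff 0 ≠ 0)
    (hfi : Irreducible f) (hfc : f ∉ Subalgebra.center K (SkewPoly σ))
    [IsGalois K L] (hσ : ∀ τ : L ≃ₐ[K] L, τ ∈ Subgroup.zpowers σ)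
    (z : HKAlgebra L' hL' γ hN f hf) :
    z ∈ algebraCentre K (HKAlgebra L' hL' γ hN f hf) ↔ ∃ c : K, c • π 1 = z := by
  constructor
  · rintro ⟨⟨hz, -, -⟩, hc⟩
    obtain ⟨a, rfl⟩ := (mem_leftNucleus_iff hd h0 hfi hfc z).1 hz
    have h1 := hc (π (X σ))
    rw [mk_const_mul hd h0, X, mk_mul h0 (isCodePoly_monomial le_rfl hd 1), mk_eq_mk] at h1
    -- The commutator with `x` has degree at most `1 < deg f`, so it vanishes in `R`, and its
    -- coefficient of `x` gives `σ a = a`.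
    have h2 := eq_zero_of_mem_span_of_lt h1 fun i hi => by
      rw [monomial_mul_monomial, monomial_mul_monomial, coeff_sub, coeff_monomial, coeff_monomial,
        if_neg (by omega), if_neg (by omega), sub_zero]
    have h3 := congrArg (fun p => p.coeff 1) h2
    simp only [monomial_mul_monomial, coeff_sub, coeff_monomial, add_zero, zero_add, if_pos,
      one_mul, pow_one, pow_zero, mul_one, map_one, coeff_zero] at h3
    obtain ⟨c, hc⟩ := exists_algebraMap_eq_of_apply_eq hσ (sub_eq_zero.1 h3).symm
    refine ⟨c, ?_⟩
    rw [← lmk_apply 1, ← map_smul, ← Algebra.algebraMap_eq_smul_one, algebraMap_eq_monomial, hc]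
    rfl
  · rintro ⟨c, rfl⟩
    refine SMulMemClass.smul_mem c ⟨⟨fun x y => ?_, fun x y => ?_, fun x y => ?_⟩, fun x => ?_⟩ <;>
    simp only [mk_one_mul hd h0, mul_mk_one h0]

variable (L' hL' γ hN f hf) in
/-- The map from the eigenring `E(f)` to `(R / Rf, ⋆_D)` induced by the identity. -/
def ofEigenring : Eigenring f →ₗ[K] HKAlgebra L' hL' γ hN f hf :=
  (((eigenIdeal f).restrictScalars K).liftQ
    ((lmk L' hL' γ hN f hf).comp (polyIdealiser f).val.toLinearMap)
    fun p hp => (mk_eq_zero (p := (p : SkewPoly σ))).2 hp).comp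
  (Submodule.Quotient.restrictScalarsEquiv K (eigenIdeal f)).symm.toLinearMap

theorem ofEigenring_mk (p : polyIdealiser f) :
    ofEigenring L' hL' γ hN f hf (Ideal.Quotient.mk _ p) = π (p : SkewPoly σ) := rfl

theorem ofEigenring_injective : Function.Injective (ofEigenring L' hL' γ hN f hf) := by
  rw [injective_iff_map_eq_zero]
  intro z hz
  obtain ⟨p, rfl⟩ := Ideal.Quotient.mk_surjective z
  rw [ofEigenring_mk, mk_eq_zero] at hz
  exact Ideal.Quotient.eq_zero_iff_mem.2 hz

/-- The nuclei and the centre of `(R / Rf, ⋆_D)`. -/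
theorem nuclei [IsGalois K L] (hσ : ∀ τ : L ≃ₐ[K] L, τ ∈ Subgroup.zpowers σ)
    (hfi : Irreducible f) (hfc : f ∉ Subalgebra.center K (SkewPoly σ)) (hd : 2 ≤ f.natDegree) :
    NonassocAlgIso K (leftNucleus K (HKAlgebra L' hL' γ hN f hf)) L' ∧
    NonassocAlgIso K (middleNucleus K (HKAlgebra L' hL' γ hN f hf)) L' ∧
    NonassocAlgIso K (rightNucleus K (HKAlgebra L' hL' γ hN f hf)) (Eigenring f) ∧
    NonassocAlgIso K (algebraCentre K (HKAlgebra L' hL' γ hN f hf)) K := by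
  have h0 := coeff_zero_ne_zero hfi hd
  have hconst : ∀ a : L, π (monomial σ 0 a) = 0 → a = 0 := fun a ha => by
    have h := congrArg (fun p => p.coeff 0) (eq_zero_of_mem_span_of_lt (mk_eq_zero.1 ha)
      fun i hi => by rw [coeff_monomial, if_neg (by omega)])
    simpa only [coeff_monomial, if_pos, coeff_zero] using h
  let j : L' →ₗ[K] HKAlgebra L' hL' γ hN f hf :=
    (lmk L' hL' γ hN f hf).comp ((lmonomial σ 0).comp L'.val.toLinearMap)
  have hj : Function.Injective j := by
    rw [injective_iff_map_eq_zero]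
    exact fun a ha => Subtype.ext (hconst a ha)
  have hjm : ∀ a b, j (a * b) = j a * j b := fun a b => by
    refine Eq.trans ?_ (mk_const_mul hd h0 a (monomial σ 0 (b : L))).symm
    rw [monomial_mul_monomial]
    rfl
  let i : K →ₗ[K] HKAlgebra L' hL' γ hN f hf := LinearMap.toSpanSingleton K _ (π 1)
  have hi : Function.Injective i := by
    rw [injective_iff_map_eq_zero]
    intro c hc
    have : π (monomial σ 0 (algebraMap K L c)) = 0 := by
      rw [← algebraMap_eq_monomial, Algebra.algebraMap_eq_smul_one]
      exact hc
    exact (map_eq_zero _).1 (hconst _ this)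
  refine ⟨nonassocAlgIso_of_mem_iff j hj hjm (mem_leftNucleus_iff hd h0 hfi hfc),
    nonassocAlgIso_of_mem_iff j hj hjm (mem_middleNucleus_iff hd h0 hfi hfc hσ),
    nonassocAlgIso_of_mem_iff (ofEigenring L' hL' γ hN f hf) ofEigenring_injective ?_ ?_,
    nonassocAlgIso_of_mem_iff i hi ?_ (mem_algebraCentre_iff hd h0 hfi hfc hσ)⟩
  · intro x y
    obtain ⟨p, rfl⟩ := Ideal.Quotient.mk_surjective x
    obtain ⟨q, rfl⟩ := Ideal.Quotient.mk_surjective y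
    rw [← map_mul, ofEigenring_mk, ofEigenring_mk, ofEigenring_mk, mk_mul_of_mul_mem h0 q.2]
    rfl
  · intro z
    constructor
    · intro hz
      obtain ⟨p, rfl⟩ := mk_surjective z
      exact ⟨Ideal.Quotient.mk _ ⟨p, (mk_mem_rightNucleus_iff hd h0 p).1 hz⟩, rfl⟩
    · rintro ⟨b, rfl⟩
      obtain ⟨p, rfl⟩ := Ideal.Quotient.mk_surjective b
      exact (mk_mem_rightNucleus_iff hd h0 p).2 p.2
  · intro x y
    change (x * y) • π 1 = (x • π 1) * (y • π 1)
    rw [smul_mul_assoc, mk_one_mul hd h0, mul_smul]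

end HKAlgebra
end

/-! ### The main theorem -/

theorem mainTheorem9 {K L : Type*} [Field K] [Field L] [Algebra K L]
    [FiniteDimensional K L] [IsGalois K L]
    (σ : L ≃ₐ[K] L) (hσ : ∀ τ : L ≃ₐ[K] L, τ ∈ Subgroup.zpowers σ)
    (L' : IntermediateField K L) (hL' : Module.finrank L' L = 2) :
    -- the nuclei and the centre of the algebra `(R / Rf, ⋆_D)`
    (∀ (f : SkewPoly σ) (hf : f.Monic), Irreducible f →
      f ∉ Subalgebra.center K (SkewPoly σ) → 2 ≤ f.natDegree →
      ∀ (γ : L) (hN : ¬ IsSquare (Algebra.norm K γ)), γ / f.coeff 0 ∉ L' →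
        NonassocAlgIso K (leftNucleus K (HKAlgebra L' hL' γ hN f hf)) L' ∧
        NonassocAlgIso K (middleNucleus K (HKAlgebra L' hL' γ hN f hf)) L' ∧
        NonassocAlgIso K (rightNucleus K (HKAlgebra L' hL' γ hN f hf)) (Eigenring f) ∧
        NonassocAlgIso K (algebraCentre K (HKAlgebra L' hL' γ hN f hf)) K) ∧
    -- the parameters of the code `D_{n,sℓ,k}(γ, F)`, with `s = deg F` and `ℓ = n / m`
    (∀ F : Polynomial K, F.Monic → Irreducible F → F ≠ Polynomial.X →
      ∀ m : ℕ, IsProductOfIrreducibles (SkewPoly.evalXPow σ F) m →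
      ∀ f : SkewPoly σ, f.Monic → Irreducible f →
      (∃ g : SkewPoly σ, g * f = SkewPoly.evalXPow σ F) →
      f ∉ Subalgebra.center K (SkewPoly σ) →
      ∀ γ : L, γ ≠ 0 → ∀ k : ℕ, 1 ≤ k → 2 * k ≤ m →
        2 ≤ F.natDegree * k * (Module.finrank K L / m) →
        -- as a subset of `R_F`
        (∀ C : Submodule K (SkewQuotient σ F),
          C = codeD σ F L' γ (F.natDegree * k * (Module.finrank K L / m)) →
          Nonempty (leftIdealiser C ≃ₐ[K] L') ∧
          Nonempty (rightIdealiser C ≃ₐ[K] L') ∧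
          Nonempty (codeCentraliser C ≃ₐ[K] centreEF σ F) ∧
          Nonempty (codeCentre C ≃ₐ[K] K)) ∧
        -- as a set of matrices, for any identification of `R_F` with `M_m(E(f))`
        (∀ (Φ : SkewQuotient σ F ≃ₐ[K] Matrix (Fin m) (Fin m) (Eigenring f))
          (C : Submodule K (Matrix (Fin m) (Fin m) (Eigenring f))),
          C = (codeD σ F L' γ (F.natDegree * k * (Module.finrank K L / m))).map
            Φ.toLinearMap →
          Nonempty (leftIdealiser C ≃ₐ[K] L') ∧
          Nonempty (rightIdealiser C ≃ₐ[K] L') ∧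
          Nonempty (codeCentraliser C ≃ₐ[K] centreEF σ F) ∧
          Nonempty (codeCentre C ≃ₐ[K] K))) := by
  refine ⟨fun f hf hfi hfc hd γ hN _ => HKAlgebra.nuclei hσ hfi hfc hd, ?_⟩
  intro F hF hFi hFX m _ f _ _ _ _ γ hγ k _ hkm hN
  -- A zero constant term makes `X` divide the monic irreducible `F`, so `F = X`.
  have hF0 : F.coeff 0 ≠ 0 := by
    intro h
    refine hFX (Polynomial.eq_of_monic_of_associated hF Polynomial.monic_X ?_)
    exact ((Polynomial.irreducible_X.associated_of_dvd hFi (Polynomial.X_dvd_iff.2 h))).symm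
  -- The bound `2k ≤ m` enters here, with `m * (n / m) ≤ n`, which holds for truncated division.
  have hNn : 2 * (F.natDegree * k * (Module.finrank K L / m)) ≤
      Module.finrank K L * F.natDegree :=
    calc 2 * (F.natDegree * k * (Module.finrank K L / m))
        = F.natDegree * ((2 * k) * (Module.finrank K L / m)) := by ring
      _ ≤ F.natDegree * (m * (Module.finrank K L / m)) := by gcongr
      _ ≤ F.natDegree * Module.finrank K L := by gcongr; exact Nat.mul_div_le _ _
      _ = Module.finrank K L * F.natDegree := mul_comm _ _
  obtain ⟨⟨e₁⟩, ⟨e₂⟩, ⟨e₃⟩, ⟨e₄⟩⟩ :=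
    invariants_codeD hσ hL' hF hF0 hγ hN hNn
  refine ⟨?_, ?_⟩
  · rintro C rfl
    exact ⟨⟨e₁⟩, ⟨e₂⟩, ⟨e₃⟩, ⟨e₄⟩⟩
  · rintro Φ C rfl
    exact ⟨(nonempty_algEquiv_of_mem_map_iff Φ fun _ =>
        apply_mem_leftIdealiser_map_iff Φ _).map (·.trans e₁),
      (nonempty_algEquiv_of_mem_map_iff Φ fun _ =>
        apply_mem_rightIdealiser_map_iff Φ _).map (·.trans e₂),
      (nonempty_algEquiv_of_mem_map_iff Φ fun _ =>
        apply_mem_codeCentraliser_map_iff Φ _).map (·.trans e₃),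
      (nonempty_algEquiv_of_mem_map_iff Φ fun _ =>
        apply_mem_codeCentre_map_iff Φ _).map (·.trans e₄)⟩
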